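/- Let $d\ge 1$ and let $D\subset B(0,1)\subset\mathbb{R}^d$ be an open set (for instance a domain) which is $0$-thick: there is $C>0$ with $$H^d\big(B(x,r)\setminus D\big)\ge C r^d\qquad\text{for all } x\in\partial D,\ 0<r<1,$$ where $H^d(S)=\inf\{\sum_i(\operatorname{diam} t_i)^d : S\subset\bigcup_{i\in\mathbb N} t_i\}$ is the $d$-dimensional Hausdorff content. Write $d(x)=\operatorname{dist}(x,\partial D)$. Let $\mathcal M$ be the set of Borel measures $\mu$ supported in $\overline{B(0,2)}\setminus D$ with $\mu(B(x,r))\le r^d$ for all $x\in\mathbb R^d$, $r>0$, and set $$U^\mu(x)=\int_0^\infty\frac{\mu(B(x,r))}{r^{d+1}}\,dr,\qquad U(x)=\sup_{\mu\in\mathcal M}U^\mu(x).$$ Call $(\delta,\eta)$, with $\delta,\eta>0$, a Binder–Braverman pair for $D$ if for every $y\in D$, every $x\in\partial D$ with $|x-y|=d(y)$ and every $\mu\in\mathcal M$, either $U(z)>U^\mu(z)+1$ for all $z\in D$ with $|z-x|<\delta d(y)$ and $d(z)>\frac{\delta}{4}d(y)$, or $\mu(B(y,2d(y)))\ge\eta\,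 d(y)^d$. Then $U$ is finite on $D$, there exists a Binder–Braverman pair $(\delta,\eta)$ for $D$ with $\delta<2$, and for every Binder–Braverman pair $(\delta,\eta)$ and every $\beta\in\,]0,1[\,\cap\,]1-\delta/2,1-\delta/4[$ there is a constant $L>0$ such that the following holds. Let $(\gamma_n)_{n\ge0}$ be i.i.d. uniform on the unit sphere of $\mathbb R^d$, let $X_0$ be a random point, independent of $(\gamma_n)$, which lies in $D$ almost surely, and let $$X_{n+1}=X_n+\beta\, d(X_n)\,\gamma_n,\qquad U_n=U(X_n),\qquad n\ge0.$$ Then for every $n\ge0$ the increment $U_{n+1}-U_n$ is integrable and $$\mathbb E[U_{n+1}-U_n\mid U_n]>L\quad\text{almost surely.}$$ The same holds, with the same $L$, for the walk stopped as soon as $d(X_n)\le\varepsilon$, for any $\varepsilon>0$, as long as it runs: for every $n\ge 0$ it holds under the conditional probability given $\{d(X_0)>\varepsilon,\dots,d(X_n)>\varepsilon\}$, whenever this event has positive probability. The constant $L$ does not depend on $n$, on $\varepsilon$, on the law of $X_0$ or on the probability space. -/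

import Mathlib

open MeasureTheory ProbabilityTheory
open scoped ENNReal

noncomputable section

namespace WalkOnSpheres

/-- The `s`-dimensional Hausdorff content: infimum of `∑ (diam tᵢ) ^ s` over all countable covers,
with no restriction on the diameters of the covering sets. -/
def hausdorffContent {d : ℕ} (s : ℝ) (S : Set (EuclideanSpace ℝ (Fin d))) : ℝ≥0∞ :=
  ⨅ (t : ℕ → Set (EuclideanSpace ℝ (Fin d))) (_ : S ⊆ ⋃ i, t i),
    ∑' i, ⨆ _ : (t i).Nonempty, Metric.ediam (t i) ^ s

/-- `0`-thickness: `H^d (B(x, r) \ D) ≥ C r ^ d` for some `C > 0`, all boundary points `x` and all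
`0 < r < 1`. -/
def IsZeroThick {d : ℕ} (D : Set (EuclideanSpace ℝ (Fin d))) : Prop :=
  ∃ C : ℝ, 0 < C ∧ ∀ x ∈ frontier D, ∀ r : ℝ, 0 < r → r < 1 →
    ENNReal.ofReal (C * r ^ d) ≤ hausdorffContent (d : ℝ) (Metric.ball x r \ D)

/-- Euclidean distance to the boundary of `D`. -/
def bdist {d : ℕ} (D : Set (EuclideanSpace ℝ (Fin d))) (x : EuclideanSpace ℝ (Fin d)) : ℝ :=
  Metric.infDist x (frontier D)

/-- The Borel measures supported in the closed ball `B(0, 2)` and outside `D` such that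
`μ (B(x, r)) ≤ r ^ d` for all `x` and all `r > 0`. (For `D` open, the set `closedBall 0 2 \ D` is
closed, so it contains the support iff its complement is null.) -/
def admissible {d : ℕ} (D : Set (EuclideanSpace ℝ (Fin d))) :
    Set (Measure (EuclideanSpace ℝ (Fin d))) :=
  {μ | μ (Metric.closedBall 0 2 \ D)ᶜ = 0 ∧
    ∀ (x : EuclideanSpace ℝ (Fin d)) (r : ℝ), 0 < r →
      μ (Metric.ball x r) ≤ ENNReal.ofReal (r ^ d)}

/-- The Riesz potential `U^μ(x) = ∫_0^∞ μ (B(x, r)) / r ^ (d + 1) dr`. -/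
def rieszPotential {d : ℕ} (μ : Measure (EuclideanSpace ℝ (Fin d)))
    (x : EuclideanSpace ℝ (Fin d)) : ℝ≥0∞ :=
  ∫⁻ r in Set.Ioi (0 : ℝ), μ (Metric.ball x r) / ENNReal.ofReal (r ^ (d + 1))

/-- The energy function `U(x) = sup_μ U^μ(x)`. -/
def energy {d : ℕ} (D : Set (EuclideanSpace ℝ (Fin d))) (x : EuclideanSpace ℝ (Fin d)) : ℝ≥0∞ :=
  ⨆ μ ∈ admissible D, rieszPotential μ x

/-- `δ`, `η` are constants for which the Binder–Braverman alternative holds: for every `y ∈ D`,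
every boundary point `x` closest to `y` and every admissible `μ`, either `U > U^μ + 1` at all
points `z ∈ D` with `|z - x| < δ d(y)` and `d(z) > (δ / 4) d(y)`, or
`μ (B(y, 2 d(y))) ≥ η d(y) ^ d`. -/
structure IsBinderBravermanPair {d : ℕ} (D : Set (EuclideanSpace ℝ (Fin d))) (δ η : ℝ) : Prop where
  delta_pos : 0 < δ
  eta_pos : 0 < η
  alternative : ∀ y ∈ D, ∀ x ∈ frontier D, dist y x = bdist D y → ∀ μ ∈ admissible D,
    (∀ z ∈ D, dist z x < δ * bdist D y → δ / 4 * bdist D y < bdist D z →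
        rieszPotential μ z + 1 < energy D z) ∨
      ENNReal.ofReal (η * bdist D y ^ d) ≤ μ (Metric.ball y (2 * bdist D y))

/-- The uniform probability measure on the unit sphere (normalized surface measure). -/
def uniformSphere (d : ℕ) : Measure (Metric.sphere (0 : EuclideanSpace ℝ (Fin d)) 1) :=
  ((volume : Measure (EuclideanSpace ℝ (Fin d))).toSphere Set.univ)⁻¹ •
    (volume : Measure (EuclideanSpace ℝ (Fin d))).toSphere

/-- `X` is a walk on spheres in `D` with parameter `β`, driven by the i.i.d. uniform directions
`γ`: `X₀` is an initial position in `D`, independent of `γ`, and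
`X_{n+1} = X_n + β d(X_n) γ_n`. -/
structure IsWalkOnSpheres {d : ℕ} (D : Set (EuclideanSpace ℝ (Fin d))) (β : ℝ)
    {Ω : Type*} [MeasurableSpace Ω] (P : Measure Ω)
    (X : ℕ → Ω → EuclideanSpace ℝ (Fin d))
    (γ : ℕ → Ω → Metric.sphere (0 : EuclideanSpace ℝ (Fin d)) 1) : Prop where
  measurable_init : Measurable (X 0)
  init_mem : ∀ᵐ ω ∂P, X 0 ω ∈ D
  measurable_dir : ∀ n, Measurable (γ n)
  law_dir : ∀ n, P.map (γ n) = uniformSphere d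
  indep_dir : iIndepFun γ P
  indep_init : IndepFun (X 0) (fun ω n => γ n ω) P
  step : ∀ n ω, X (n + 1) ω =
    X n ω + (β * bdist D (X n ω)) • (γ n ω : EuclideanSpace ℝ (Fin d))

/-- The process `U_n = U(X_n)`. -/
def energyProcess {d : ℕ} (D : Set (EuclideanSpace ℝ (Fin d))) {Ω : Type*}
    (X : ℕ → Ω → EuclideanSpace ℝ (Fin d)) (n : ℕ) (ω : Ω) : ℝ :=
  (energy D (X n ω)).toReal

/-- Under `Q`, the increment `U_{n+1} - U_n` is integrable and
`𝔼_Q[U_{n+1} - U_n | U_n] > L` almost surely. -/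
def HasDrift {d : ℕ} (D : Set (EuclideanSpace ℝ (Fin d))) {Ω : Type*} [MeasurableSpace Ω]
    (Q : Measure Ω) (X : ℕ → Ω → EuclideanSpace ℝ (Fin d)) (n : ℕ) (L : ℝ) : Prop :=
  Integrable (fun ω => energyProcess D X (n + 1) ω - energyProcess D X n ω) Q ∧
    ∀ᵐ ω ∂Q, L <
      (Q[fun ω => energyProcess D X (n + 1) ω - energyProcess D X n ω |
        MeasurableSpace.comap (energyProcess D X n) inferInstance]) ω

/-- The event that the walk stopped as soon as `d(X_k) ≤ ε` is still running at time `n`, so that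
the step from `X_n` to `X_{n+1}` is performed. -/
def running {d : ℕ} (D : Set (EuclideanSpace ℝ (Fin d))) {Ω : Type*}
    (X : ℕ → Ω → EuclideanSpace ℝ (Fin d)) (ε : ℝ) (n : ℕ) : Set Ω :=
  {ω | ∀ k ≤ n, ε < bdist D (X k ω)}

end WalkOnSpheres

end

/-!
Let `λ` be Lebesgue measure normalized so that `λ (B(x, r)) = r ^ d`. The growth condition
`μ (B(x, r)) ≤ r ^ d` is equivalent to `μ ≤ λ`, by the Besicovitch covering theorem
(`le_extremalMeasure`). The supremum defining the energy `U` is therefore attained at every point by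
one and the same measure `m`, the restriction of `λ` to `closedBall 0 2 \ D`
(`energy_eq_rieszPotential`), and on `D` the energy is `U(x) = ∫ |x - p| ^ (-d) / d dm(p)`
(`energy_eq_ofReal_integral`), which is finite because `m` is finite and lives at distance at least
`d(x)` from `x`. Hausdorff content in dimension `d` is at most a multiple of Lebesgue measure, so
thickness says that `m (B(x, r)) ≥ c r ^ d` at boundary points `x`
(`exists_le_extremalMeasure_ball`).

A measure `μ` with little mass in `B(y, 2 d(y))` misses at least half of the lower bound for `m` in
all balls `B(z, r)` with `2δ d(y) < r ≤ d(y) / 2`, for `z` close to the boundary point nearest to `y`;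
integrating over `r` gives a deficit of order `log (1 / (4δ))`, which exceeds `1` for small `δ`. This
produces a Binder–Braverman pair (`exists_isBinderBravermanPair`).

The drift comes from the strict subharmonicity of the Riesz kernel `v ↦ ‖v‖ ^ (-d)`. Up to scaling,
its restriction to a sphere not surrounding the origin is the Poisson kernel of a ball, so its mean
over the sphere of radius `ρ` around `w` equals `‖w‖ ^ (-d) (1 - ρ² / ‖w‖²)⁻¹`
(`integral_norm_add_smul_pow_inv`). The Poisson integral is computed from two instances of Gauss'
law, obtained by differentiating in the radius and integrating by parts on the sphere; the
integration by parts is the infinitesimal form of rotation invariance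
(`integral_one_sub_inner_sq_mul_deriv`). With `ρ = β d(y)`, each point `p` of the complement in
`B(y, 2 d(y))` contributes an increment of order `d(y) ^ (-d)`, and by thickness these points have
`m`-mass of order `d(y) ^ d`; the mean increment of `U` is thus bounded below on `D`
(`exists_le_integral_energyIncrement`).

The energy may be unbounded, but its increments are bounded, as the kernel increments decay like
`d(y) ‖y - p‖ ^ (-d - 1)` (`exists_abs_energyIncrement_le`). Finally, the direction at time `n` is
independent of the past, so the pointwise bound integrates to a lower bound for the mean increment
over every event of the past, in particular over the events in `σ(U_n)` intersected with the event
that the stopped walk is still running (`IsWalkOnSpheres.hasDrift_cond`).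
-/

namespace WalkOnSpheres

/-! ### Differentiation under the integral sign and rotations -/

/-- Differentiation under the integral sign for a jointly continuous derivative on a compact
space. -/
lemma hasDerivAt_integral_of_continuousOn {X : Type*} [TopologicalSpace X] [CompactSpace X]
    [SecondCountableTopology X] [MeasurableSpace X] [OpensMeasurableSpace X] (μ : Measure X)
    [IsFiniteMeasure μ] {F F' : ℝ → X → ℝ} {U : Set ℝ} (hU : IsOpen U)
    (hF : ∀ θ ∈ U, Continuous (F θ)) (hF' : ContinuousOn (Function.uncurry F') (U ×ˢ Set.univ))
    (hd : ∀ θ ∈ U, ∀ x, HasDerivAt (fun θ => F θ x) (F' θ x) θ) {θ : ℝ} (hθ : θ ∈ U) :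
    HasDerivAt (fun θ => ∫ x, F θ x ∂μ) (∫ x, F' θ x ∂μ) θ := by
  obtain ⟨ε, hε, hsub⟩ := Metric.nhds_basis_closedBall.mem_iff.1 (hU.mem_nhds hθ)
  have hK : IsCompact (Metric.closedBall θ ε ×ˢ (Set.univ : Set X)) :=
    (isCompact_closedBall θ ε).prod isCompact_univ
  obtain ⟨C, hC⟩ := hK.exists_bound_of_continuousOn
    (hF'.mono (Set.prod_mono hsub subset_rfl))
  have hint : ∀ f : X → ℝ, Continuous f → AEStronglyMeasurable f μ := fun f hf =>
    hf.aestronglyMeasurable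
  have hcont : Continuous (F' θ) := by
    have : Continuous (fun x : X => (θ, x)) := by fun_prop
    exact hF'.comp_continuous this fun x => ⟨hθ, trivial⟩
  refine (hasDerivAt_integral_of_dominated_loc_of_deriv_le (bound := fun _ => C)
    (Metric.closedBall_mem_nhds θ hε) ?_ ?_ ?_ ?_ ?_ ?_).2
  · filter_upwards [hU.mem_nhds hθ] with t ht using hint _ (hF t ht)
  · exact (hF θ hθ).integrable_of_hasCompactSupport (HasCompactSupport.of_compactSpace _)
  · exact hint _ hcont
  · exact Filter.Eventually.of_forall fun x t ht => hC (t, x) ⟨ht, trivial⟩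
  · exact integrable_const C
  · exact Filter.Eventually.of_forall fun x t ht => hd t (hsub ht) x

section Rotation

variable {E : Type*} [NormedAddCommGroup E] [InnerProductSpace ℝ E]

/-- The rotation by the angle `θ` in the oriented plane spanned by `e` and `u`, the identity on the
orthogonal complement (a rotation when `e`, `u` are orthonormal). -/
noncomputable def planeRotation (e u : E) (θ : ℝ) : E →ₗ[ℝ] E :=
  LinearMap.id +
    ((Real.cos θ - 1) • innerₛₗ ℝ e - Real.sin θ • innerₛₗ ℝ u).smulRight e +
    ((Real.cos θ - 1) • innerₛₗ ℝ u + Real.sin θ • innerₛₗ ℝ e).smulRight u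

lemma planeRotation_apply (e u : E) (θ : ℝ) (v : E) :
    planeRotation e u θ v = v +
      ((Real.cos θ - 1) * inner ℝ e v - Real.sin θ * inner ℝ u v) • e +
      ((Real.cos θ - 1) * inner ℝ u v + Real.sin θ * inner ℝ e v) • u := by
  simp [planeRotation]

lemma inner_left_planeRotation {e u : E} (he : ‖e‖ = 1) (heu : inner ℝ e u = 0) (θ : ℝ) (v : E) :
    inner ℝ e (planeRotation e u θ v) =
      Real.cos θ * inner ℝ e v - Real.sin θ * inner ℝ u v := by
  rw [planeRotation_apply, inner_add_right, inner_add_right, inner_smul_right, inner_smul_right,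
    heu, real_inner_self_eq_norm_sq, he]
  ring

lemma inner_right_planeRotation {e u : E} (hu : ‖u‖ = 1) (heu : inner ℝ e u = 0) (θ : ℝ) (v : E) :
    inner ℝ u (planeRotation e u θ v) =
      Real.cos θ * inner ℝ u v + Real.sin θ * inner ℝ e v := by
  rw [planeRotation_apply, inner_add_right, inner_add_right, inner_smul_right, inner_smul_right,
    real_inner_comm e u, heu, real_inner_self_eq_norm_sq, hu]
  ring

lemma norm_planeRotation {e u : E} (he : ‖e‖ = 1) (hu : ‖u‖ = 1) (heu : inner ℝ e u = 0)
    (θ : ℝ) (v : E) : ‖planeRotation e u θ v‖ = ‖v‖ := by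
  have h : ‖planeRotation e u θ v‖ ^ 2 = ‖v‖ ^ 2 := by
    have h1 := inner_left_planeRotation he heu θ v
    have h2 := inner_right_planeRotation hu heu θ v
    rw [← real_inner_self_eq_norm_sq]
    nth_rewrite 1 [planeRotation_apply]
    rw [inner_add_left, inner_add_left, inner_smul_left, inner_smul_left, h1, h2,
      planeRotation_apply, inner_add_right, inner_add_right, inner_smul_right, inner_smul_right,
      real_inner_self_eq_norm_sq, real_inner_comm e v, real_inner_comm u v]
    simp only [conj_trivial]
    linear_combination (inner ℝ e v ^ 2 + inner ℝ u v ^ 2) * Real.sin_sq_add_cos_sq θ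
  exact (sq_eq_sq₀ (norm_nonneg _) (norm_nonneg _)).1 h

end Rotation

section Sphere

variable {d : ℕ}

/-- The homeomorphism of the unit sphere induced by a linear isometry. -/
noncomputable def sphereHomeomorph
    (A : EuclideanSpace ℝ (Fin d) ≃ₗᵢ[ℝ] EuclideanSpace ℝ (Fin d)) :
    Metric.sphere (0 : EuclideanSpace ℝ (Fin d)) 1 ≃ₜ
      Metric.sphere (0 : EuclideanSpace ℝ (Fin d)) 1 :=
  A.toHomeomorph.subtype fun x => by simp

open scoped Pointwise in
lemma measurePreserving_sphereHomeomorph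
    (A : EuclideanSpace ℝ (Fin d) ≃ₗᵢ[ℝ] EuclideanSpace ℝ (Fin d)) :
    MeasurePreserving (sphereHomeomorph A) (uniformSphere d) (uniformSphere d) := by
  refine MeasurePreserving.smul_measure (μa := Measure.toSphere volume)
    (μb := Measure.toSphere volume) ⟨(sphereHomeomorph A).continuous.measurable, ?_⟩ _
  ext s hs
  rw [Measure.map_apply (sphereHomeomorph A).continuous.measurable hs,
    Measure.toSphere_apply' _ hs,
    Measure.toSphere_apply' _ ((sphereHomeomorph A).continuous.measurable hs)]
  congr 1
  rw [← A.measurePreserving.measure_preimage_equiv (f := A.toMeasurableEquiv)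
    (Set.Ioo (0 : ℝ) 1 • (Subtype.val '' s))]
  congr 1
  ext v
  simp only [Set.mem_smul, Set.mem_preimage, Set.mem_image]
  constructor
  · rintro ⟨r, hr, _, ⟨y, hy, rfl⟩, rfl⟩
    exact ⟨r, hr, _, ⟨_, hy, rfl⟩, (A.map_smul r _).symm⟩
  · rintro ⟨r, hr, _, ⟨y, hy, rfl⟩, h⟩
    refine ⟨r, hr, _, ⟨(sphereHomeomorph A).symm y, by simpa using hy, rfl⟩, ?_⟩
    apply A.injective
    rw [A.map_smul]
    have hy' : A ((sphereHomeomorph A).symm y : EuclideanSpace ℝ (Fin d)) = y :=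
      congrArg Subtype.val ((sphereHomeomorph A).apply_symm_apply y)
    rw [hy']
    exact h

lemma integral_uniformSphere_isometry
    (A : EuclideanSpace ℝ (Fin d) ≃ₗᵢ[ℝ] EuclideanSpace ℝ (Fin d))
    (F : EuclideanSpace ℝ (Fin d) → ℝ) :
    ∫ γ, F (A γ) ∂uniformSphere d = ∫ γ, F γ ∂uniformSphere d :=
  (measurePreserving_sphereHomeomorph A).integral_comp
    (sphereHomeomorph A).measurableEmbedding (fun γ => F γ)

lemma isProbabilityMeasure_uniformSphere (hd : 1 ≤ d) :
    IsProbabilityMeasure (uniformSphere d) := by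
  have : Nonempty (Fin d) := ⟨⟨0, hd⟩⟩
  refine ⟨?_⟩
  rw [uniformSphere, Measure.smul_apply, smul_eq_mul]
  refine ENNReal.inv_mul_cancel ?_ (measure_ne_top _ _)
  rw [Ne, Measure.measure_univ_eq_zero]
  exact Measure.toSphere_ne_zero _

end Sphere

/-! ### The Poisson kernel identity on the sphere -/

section MeanValue

variable {d : ℕ}

lemma inner_mem_Icc {e : EuclideanSpace ℝ (Fin d)} (he : ‖e‖ = 1)
    (γ : Metric.sphere (0 : EuclideanSpace ℝ (Fin d)) 1) :
    inner ℝ e (γ : EuclideanSpace ℝ (Fin d)) ∈ Set.Icc (-1 : ℝ) 1 := by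
  have h := abs_real_inner_le_norm e (γ : EuclideanSpace ℝ (Fin d))
  rw [he, norm_eq_of_mem_sphere γ, one_mul] at h
  exact abs_le.1 h

lemma integrable_of_continuous_sphere (hd : 1 ≤ d)
    {f : Metric.sphere (0 : EuclideanSpace ℝ (Fin d)) 1 → ℝ} (hf : Continuous f) :
    Integrable f (uniformSphere d) := by
  have := isProbabilityMeasure_uniformSphere hd
  exact hf.integrable_of_hasCompactSupport (HasCompactSupport.of_compactSpace _)

/-- Infinitesimal form of the invariance of the uniform measure under the rotations in the plane
spanned by `e` and `u`. -/
lemma integral_inner_sq_mul_deriv (hd : 1 ≤ d) {e u : EuclideanSpace ℝ (Fin d)} (he : ‖e‖ = 1)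
    (hu : ‖u‖ = 1) (heu : inner ℝ e u = 0) {g g' : ℝ → ℝ}
    (hg : ∀ t ∈ Set.Icc (-1 : ℝ) 1, HasDerivAt g (g' t) t)
    (hg' : ContinuousOn g' (Set.Icc (-1 : ℝ) 1)) :
    ∫ γ, inner ℝ u (γ : EuclideanSpace ℝ (Fin d)) ^ 2 *
        g' (inner ℝ e (γ : EuclideanSpace ℝ (Fin d))) ∂uniformSphere d =
      ∫ γ, inner ℝ e (γ : EuclideanSpace ℝ (Fin d)) *
        g (inner ℝ e (γ : EuclideanSpace ℝ (Fin d))) ∂uniformSphere d := by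
  have := isProbabilityMeasure_uniformSphere hd
  set t : Metric.sphere (0 : EuclideanSpace ℝ (Fin d)) 1 → ℝ :=
    fun γ => inner ℝ e (γ : EuclideanSpace ℝ (Fin d)) with ht
  set y : Metric.sphere (0 : EuclideanSpace ℝ (Fin d)) 1 → ℝ :=
    fun γ => inner ℝ u (γ : EuclideanSpace ℝ (Fin d)) with hy
  have htc : Continuous t := by rw [ht]; fun_prop
  have hyc : Continuous y := by rw [hy]; fun_prop
  have hgc : ContinuousOn g (Set.Icc (-1 : ℝ) 1) := fun x hx =>
    (hg x hx).continuousAt.continuousWithinAt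
  let A : ℝ → (EuclideanSpace ℝ (Fin d) ≃ₗᵢ[ℝ] EuclideanSpace ℝ (Fin d)) := fun θ =>
    LinearIsometry.toLinearIsometryEquiv
      ⟨planeRotation e u θ, norm_planeRotation he hu heu θ⟩ rfl
  have hAe : ∀ θ (γ : Metric.sphere (0 : EuclideanSpace ℝ (Fin d)) 1), inner ℝ e (A θ γ) =
      Real.cos θ * t γ - Real.sin θ * y γ := fun θ γ =>
    inner_left_planeRotation he heu θ γ
  have hAu : ∀ θ (γ : Metric.sphere (0 : EuclideanSpace ℝ (Fin d)) 1), inner ℝ u (A θ γ) =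
      Real.cos θ * y γ + Real.sin θ * t γ := fun θ γ =>
    inner_right_planeRotation hu heu θ γ
  have hmem : ∀ θ γ, Real.cos θ * t γ - Real.sin θ * y γ ∈ Set.Icc (-1 : ℝ) 1 := fun θ γ => by
    rw [← hAe]
    exact inner_mem_Icc he (sphereHomeomorph (A θ) γ)
  set F : ℝ → Metric.sphere (0 : EuclideanSpace ℝ (Fin d)) 1 → ℝ := fun θ γ =>
    g (Real.cos θ * t γ - Real.sin θ * y γ) * (Real.cos θ * y γ + Real.sin θ * t γ) with hF
  set F' : ℝ → Metric.sphere (0 : EuclideanSpace ℝ (Fin d)) 1 → ℝ := fun θ γ =>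
    g' (Real.cos θ * t γ - Real.sin θ * y γ) * (-Real.sin θ * t γ - Real.cos θ * y γ) *
        (Real.cos θ * y γ + Real.sin θ * t γ) +
      g (Real.cos θ * t γ - Real.sin θ * y γ) * (-Real.sin θ * y γ + Real.cos θ * t γ) with hF'
  have hconst : ∀ θ, ∫ γ, F θ γ ∂uniformSphere d = ∫ γ, F 0 γ ∂uniformSphere d := fun θ => by
    have h := integral_uniformSphere_isometry (A θ) fun v => g (inner ℝ e v) * inner ℝ u v
    simp only [hAe, hAu] at h
    simp only [hF, h, Real.cos_zero, Real.sin_zero]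
    simp [ht, hy]
  have hderiv : HasDerivAt (fun θ => ∫ γ, F θ γ ∂uniformSphere d)
      (∫ γ, F' 0 γ ∂uniformSphere d) 0 := by
    refine hasDerivAt_integral_of_continuousOn _ isOpen_univ ?_ ?_ ?_ (Set.mem_univ 0)
    · intro θ _
      exact (hgc.comp_continuous (by fun_prop) (hmem θ)).mul (by fun_prop)
    · refine Continuous.continuousOn ?_
      have h1 : Continuous fun p : ℝ × Metric.sphere (0 : EuclideanSpace ℝ (Fin d)) 1 =>
          Real.cos p.1 * t p.2 - Real.sin p.1 * y p.2 := by fun_prop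
      have h2 := hgc.comp_continuous h1 fun p => hmem p.1 p.2
      have h3 := hg'.comp_continuous h1 fun p => hmem p.1 p.2
      exact ((h3.mul (by fun_prop)).mul (by fun_prop)).add (h2.mul (by fun_prop))
    · intro θ _ γ
      have h1 : HasDerivAt (fun θ => Real.cos θ * t γ - Real.sin θ * y γ)
          (-Real.sin θ * t γ - Real.cos θ * y γ) θ :=
        ((Real.hasDerivAt_cos θ).mul_const _).sub ((Real.hasDerivAt_sin θ).mul_const _)
      have h2 : HasDerivAt (fun θ => Real.cos θ * y γ + Real.sin θ * t γ)
          (-Real.sin θ * y γ + Real.cos θ * t γ) θ :=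
        ((Real.hasDerivAt_cos θ).mul_const _).add ((Real.hasDerivAt_sin θ).mul_const _)
      exact ((hg _ (hmem θ γ)).comp θ h1).mul h2
  have h0 : ∫ γ, F' 0 γ ∂uniformSphere d = 0 := by
    refine hderiv.unique ?_
    simp only [hconst]
    exact hasDerivAt_const _ _
  have h1 : ∀ γ, F' 0 γ = t γ * g (t γ) - y γ ^ 2 * g' (t γ) := fun γ => by
    simp only [hF', Real.cos_zero, Real.sin_zero, one_mul, zero_mul, sub_zero, neg_zero, zero_sub,
      add_zero, zero_add]
    ring
  simp only [h1] at h0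
  rw [integral_sub] at h0
  · linarith
  · exact integrable_of_continuous_sphere hd
      (htc.mul (hgc.comp_continuous htc (inner_mem_Icc he)))
  · exact integrable_of_continuous_sphere hd
      ((hyc.pow 2).mul (hg'.comp_continuous htc (inner_mem_Icc he)))

/-- Integration by parts on the sphere for functions of one coordinate `t = ⟪e, γ⟫`: summing the
infinitesimal rotation invariance over the planes spanned by `e` and the other vectors of an
orthonormal basis. -/
lemma integral_one_sub_inner_sq_mul_deriv (hd : 1 ≤ d) {e : EuclideanSpace ℝ (Fin d)}
    (he : ‖e‖ = 1) {g g' : ℝ → ℝ} (hg : ∀ t ∈ Set.Icc (-1 : ℝ) 1, HasDerivAt g (g' t) t)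
    (hg' : ContinuousOn g' (Set.Icc (-1 : ℝ) 1)) :
    ∫ γ, (1 - inner ℝ e (γ : EuclideanSpace ℝ (Fin d)) ^ 2) *
        g' (inner ℝ e (γ : EuclideanSpace ℝ (Fin d))) ∂uniformSphere d =
      (d - 1) * ∫ γ, inner ℝ e (γ : EuclideanSpace ℝ (Fin d)) *
        g (inner ℝ e (γ : EuclideanSpace ℝ (Fin d))) ∂uniformSphere d := by
  let i₀ : Fin d := ⟨0, hd⟩
  obtain ⟨b, hb⟩ := Orthonormal.exists_orthonormalBasis_extension_of_card_eq (𝕜 := ℝ)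
    (E := EuclideanSpace ℝ (Fin d)) (ι := Fin d) (by simp) (v := fun _ => e) (s := {i₀}) (by
      refine ⟨fun _ => he, fun i j hij => (hij (Subsingleton.elim i j)).elim⟩)
  have hbe : b i₀ = e := hb i₀ rfl
  have hsum : ∀ γ : Metric.sphere (0 : EuclideanSpace ℝ (Fin d)) 1,
      1 - inner ℝ e (γ : EuclideanSpace ℝ (Fin d)) ^ 2 =
        ∑ i ∈ Finset.univ.erase i₀, inner ℝ (b i) (γ : EuclideanSpace ℝ (Fin d)) ^ 2 := fun γ => by
    have h := b.sum_sq_norm_inner_right (γ : EuclideanSpace ℝ (Fin d))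
    rw [norm_eq_of_mem_sphere γ, ← Finset.add_sum_erase _ _ (Finset.mem_univ i₀), hbe] at h
    simp only [Real.norm_eq_abs, sq_abs] at h
    linarith
  have htc : Continuous fun γ : Metric.sphere (0 : EuclideanSpace ℝ (Fin d)) 1 =>
      inner ℝ e (γ : EuclideanSpace ℝ (Fin d)) := by fun_prop
  simp only [hsum, Finset.sum_mul]
  rw [integral_finsetSum]
  · rw [Finset.sum_congr rfl fun i hi => integral_inner_sq_mul_deriv hd he (b.norm_eq_one i)
      (by rw [← hbe]; exact b.inner_eq_zero (Finset.ne_of_mem_erase hi).symm) hg hg']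
    rw [Finset.sum_const, Finset.card_erase_of_mem (Finset.mem_univ _), Finset.card_univ,
      Fintype.card_fin, nsmul_eq_mul, Nat.cast_sub hd, Nat.cast_one]
  · intro i _
    refine integrable_of_continuous_sphere hd (Continuous.mul (by fun_prop) ?_)
    exact hg'.comp_continuous htc (inner_mem_Icc he)

lemma integral_inner_uniformSphere (e : EuclideanSpace ℝ (Fin d)) :
    ∫ γ, inner ℝ e (γ : EuclideanSpace ℝ (Fin d)) ∂uniformSphere d = 0 := by
  have h := integral_uniformSphere_isometry (LinearIsometryEquiv.neg ℝ) fun v => inner ℝ e v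
  simp only [LinearIsometryEquiv.coe_neg, inner_neg_right, integral_neg] at h
  linarith

end MeanValue

section Poisson

variable {d : ℕ}

lemma one_add_sq_add_pos {ρ t : ℝ} (hρ : ρ ∈ Set.Ioo (-1 : ℝ) 1) (ht : t ∈ Set.Icc (-1 : ℝ) 1) :
    0 < 1 + ρ ^ 2 + 2 * ρ * t := by
  have h1 : 0 < 1 - ρ ^ 2 := by nlinarith [hρ.1, hρ.2]
  nlinarith [sq_nonneg (ρ + t), ht.1, ht.2, mul_nonneg (sub_nonneg.2 ht.1) (sub_nonneg.2 ht.2)]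

lemma rpow_eq_mul_rpow_sub_one {a : ℝ} (ha : 0 < a) (p : ℝ) : a ^ p = a * a ^ (p - 1) := by
  rw [Real.rpow_sub_one ha.ne']
  field_simp

/-- The integration by parts formula applied to `t ↦ (1 + ρ² + 2ρt) ^ (-d/2)`. -/
lemma integral_deriv_kernel_parts (hd : 1 ≤ d) {e : EuclideanSpace ℝ (Fin d)} (he : ‖e‖ = 1)
    {ρ : ℝ} (hρ : ρ ∈ Set.Ioo (-1 : ℝ) 1) :
    ∫ γ, ((d - 1) * inner ℝ e (γ : EuclideanSpace ℝ (Fin d)) *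
          (1 + ρ ^ 2 + 2 * ρ * inner ℝ e (γ : EuclideanSpace ℝ (Fin d))) ^ (-(d : ℝ) / 2) +
        d * ρ * (1 - inner ℝ e (γ : EuclideanSpace ℝ (Fin d)) ^ 2) *
          (1 + ρ ^ 2 + 2 * ρ * inner ℝ e (γ : EuclideanSpace ℝ (Fin d))) ^ (-(d : ℝ) / 2 - 1))
      ∂uniformSphere d = 0 := by
  have hpos := fun γ : Metric.sphere (0 : EuclideanSpace ℝ (Fin d)) 1 =>
    one_add_sq_add_pos hρ (inner_mem_Icc he γ)
  have hc : ∀ p : ℝ, Continuous fun γ : Metric.sphere (0 : EuclideanSpace ℝ (Fin d)) 1 =>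
      (1 + ρ ^ 2 + 2 * ρ * inner ℝ e (γ : EuclideanSpace ℝ (Fin d))) ^ p := fun p =>
    Continuous.rpow_const (by fun_prop) fun γ => Or.inl (hpos γ).ne'
  have h := integral_one_sub_inner_sq_mul_deriv hd he
    (g := fun t => (1 + ρ ^ 2 + 2 * ρ * t) ^ (-(d : ℝ) / 2))
    (g' := fun t => -(d * ρ) * (1 + ρ ^ 2 + 2 * ρ * t) ^ (-(d : ℝ) / 2 - 1))
    (fun t ht => by
      have h1 : HasDerivAt (fun t => 1 + ρ ^ 2 + 2 * ρ * t) (2 * ρ) t := by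
        simpa using ((hasDerivAt_id t).const_mul (2 * ρ)).const_add (1 + ρ ^ 2)
      convert h1.rpow_const (p := -(d : ℝ) / 2) (Or.inl (one_add_sq_add_pos hρ ht).ne') using 1
      ring)
    (ContinuousOn.mul continuousOn_const (ContinuousOn.rpow_const (by fun_prop)
      fun t ht => Or.inl (one_add_sq_add_pos hρ ht).ne'))
  have h2 := hc (-(d : ℝ) / 2)
  have h3 := hc (-(d : ℝ) / 2 - 1)
  refine Eq.trans ?_ (sub_eq_zero.2 h.symm)
  rw [← integral_const_mul, ← integral_sub (integrable_of_continuous_sphere hd (by fun_prop))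
    (integrable_of_continuous_sphere hd (by fun_prop))]
  refine integral_congr_ae (Filter.Eventually.of_forall fun γ => ?_)
  simp only
  ring

/-- Derivative in the radius of the spherical mean of the kernel `(1 + ρ² + 2ρt) ^ (-d/2)` with a
weight `l ρ t`, where `t = ⟪e, γ⟫`. -/
lemma hasDerivAt_integral_kernel (hd : 1 ≤ d) {e : EuclideanSpace ℝ (Fin d)} (he : ‖e‖ = 1)
    {l l' : ℝ → ℝ → ℝ} (hl : Continuous (Function.uncurry l))
    (hl' : Continuous (Function.uncurry l'))
    (hll : ∀ ρ t, HasDerivAt (fun ρ => l ρ t) (l' ρ t) ρ) {ρ : ℝ} (hρ : ρ ∈ Set.Ioo (-1 : ℝ) 1) :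
    HasDerivAt (fun ρ => ∫ γ, l ρ (inner ℝ e (γ : EuclideanSpace ℝ (Fin d))) *
        (1 + ρ ^ 2 + 2 * ρ * inner ℝ e (γ : EuclideanSpace ℝ (Fin d))) ^ (-(d : ℝ) / 2)
          ∂uniformSphere d)
      (∫ γ, (l' ρ (inner ℝ e (γ : EuclideanSpace ℝ (Fin d))) *
        (1 + ρ ^ 2 + 2 * ρ * inner ℝ e (γ : EuclideanSpace ℝ (Fin d))) ^ (-(d : ℝ) / 2) -
        d * (ρ + inner ℝ e (γ : EuclideanSpace ℝ (Fin d))) *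
          l ρ (inner ℝ e (γ : EuclideanSpace ℝ (Fin d))) *
          (1 + ρ ^ 2 + 2 * ρ * inner ℝ e (γ : EuclideanSpace ℝ (Fin d))) ^ (-(d : ℝ) / 2 - 1))
            ∂uniformSphere d) ρ := by
  have := isProbabilityMeasure_uniformSphere hd
  refine hasDerivAt_integral_of_continuousOn (U := Set.Ioo (-1) 1)
    (X := Metric.sphere (0 : EuclideanSpace ℝ (Fin d)) 1)
    (F := fun ρ γ => l ρ (inner ℝ e (γ : EuclideanSpace ℝ (Fin d))) *
        (1 + ρ ^ 2 + 2 * ρ * inner ℝ e (γ : EuclideanSpace ℝ (Fin d))) ^ (-(d : ℝ) / 2))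
    (F' := fun ρ γ => l' ρ (inner ℝ e (γ : EuclideanSpace ℝ (Fin d))) *
        (1 + ρ ^ 2 + 2 * ρ * inner ℝ e (γ : EuclideanSpace ℝ (Fin d))) ^ (-(d : ℝ) / 2) -
        d * (ρ + inner ℝ e (γ : EuclideanSpace ℝ (Fin d))) *
          l ρ (inner ℝ e (γ : EuclideanSpace ℝ (Fin d))) *
          (1 + ρ ^ 2 + 2 * ρ * inner ℝ e (γ : EuclideanSpace ℝ (Fin d))) ^ (-(d : ℝ) / 2 - 1))
    _ isOpen_Ioo ?_ ?_ ?_ hρ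
  · intro r hr
    have h1 : Continuous fun γ : Metric.sphere (0 : EuclideanSpace ℝ (Fin d)) 1 =>
      (1 + r ^ 2 + 2 * r * inner ℝ e (γ : EuclideanSpace ℝ (Fin d))) ^ (-(d : ℝ) / 2) :=
      Continuous.rpow_const (by fun_prop) fun γ =>
        Or.inl (one_add_sq_add_pos hr (inner_mem_Icc he γ)).ne'
    have h2 : Continuous fun γ : Metric.sphere (0 : EuclideanSpace ℝ (Fin d)) 1 =>
      l r (inner ℝ e (γ : EuclideanSpace ℝ (Fin d))) :=
      hl.comp (f := fun γ : Metric.sphere (0 : EuclideanSpace ℝ (Fin d)) 1 =>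
        (r, inner ℝ e (γ : EuclideanSpace ℝ (Fin d)))) (by fun_prop)
    exact h2.mul h1
  · have h1 : ∀ p : ℝ, ContinuousOn
        (fun x : ℝ × Metric.sphere (0 : EuclideanSpace ℝ (Fin d)) 1 =>
          (1 + x.1 ^ 2 + 2 * x.1 * inner ℝ e (x.2 : EuclideanSpace ℝ (Fin d))) ^ p)
        (Set.Ioo (-1) 1 ×ˢ Set.univ) := fun p =>
      ContinuousOn.rpow_const (by fun_prop) fun x hx =>
        Or.inl (one_add_sq_add_pos hx.1 (inner_mem_Icc he x.2)).ne'
    have h2 : Continuous fun x : ℝ × Metric.sphere (0 : EuclideanSpace ℝ (Fin d)) 1 =>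
      l x.1 (inner ℝ e (x.2 : EuclideanSpace ℝ (Fin d))) :=
      hl.comp (f := fun x : ℝ × Metric.sphere (0 : EuclideanSpace ℝ (Fin d)) 1 =>
        (x.1, inner ℝ e (x.2 : EuclideanSpace ℝ (Fin d)))) (by fun_prop)
    have h3 : Continuous fun x : ℝ × Metric.sphere (0 : EuclideanSpace ℝ (Fin d)) 1 =>
      l' x.1 (inner ℝ e (x.2 : EuclideanSpace ℝ (Fin d))) :=
      hl'.comp (f := fun x : ℝ × Metric.sphere (0 : EuclideanSpace ℝ (Fin d)) 1 =>
        (x.1, inner ℝ e (x.2 : EuclideanSpace ℝ (Fin d)))) (by fun_prop)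
    exact (h3.continuousOn.mul (h1 _)).sub
      ((Continuous.continuousOn (by fun_prop)).mul (h1 _))
  · intro r hr γ
    have hp := one_add_sq_add_pos hr (inner_mem_Icc he γ)
    have h1 : HasDerivAt
        (fun ρ => 1 + ρ ^ 2 + 2 * ρ * inner ℝ e (γ : EuclideanSpace ℝ (Fin d)))
        (2 * r + 2 * inner ℝ e (γ : EuclideanSpace ℝ (Fin d))) r := by
      refine (((hasDerivAt_pow 2 r).const_add 1).add
        (((hasDerivAt_id r).const_mul 2).mul_const
          (inner ℝ e (γ : EuclideanSpace ℝ (Fin d))))).congr_deriv ?_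
      norm_num
    refine ((hll r (inner ℝ e (γ : EuclideanSpace ℝ (Fin d)))).mul
      (h1.rpow_const (p := -(d : ℝ) / 2) (Or.inl hp.ne'))).congr_deriv ?_
    ring

/-- Gauss' law: the flux of `v ↦ v / ‖v‖ ^ d` through the unit sphere around an interior point. -/
lemma integral_gauss_interior (hd : 1 ≤ d) {e : EuclideanSpace ℝ (Fin d)} (he : ‖e‖ = 1)
    {ρ : ℝ} (hρ₀ : 0 < ρ) (hρ₁ : ρ < 1) :
    ∫ γ, (1 + ρ * inner ℝ e (γ : EuclideanSpace ℝ (Fin d))) *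
      (1 + ρ ^ 2 + 2 * ρ * inner ℝ e (γ : EuclideanSpace ℝ (Fin d))) ^ (-(d : ℝ) / 2)
        ∂uniformSphere d = 1 := by
  have := isProbabilityMeasure_uniformSphere hd
  have hder : ∀ r ∈ Set.Ioo (-1 : ℝ) 1, HasDerivAt (fun ρ =>
      ∫ γ, (1 + ρ * inner ℝ e (γ : EuclideanSpace ℝ (Fin d))) *
      (1 + ρ ^ 2 + 2 * ρ * inner ℝ e (γ : EuclideanSpace ℝ (Fin d))) ^ (-(d : ℝ) / 2)
        ∂uniformSphere d) 0 r := fun r hr => by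
    convert hasDerivAt_integral_kernel hd he (l := fun ρ t => 1 + ρ * t) (l' := fun _ t => t)
      (by fun_prop) (by fun_prop) (fun r t => by
        simpa using ((hasDerivAt_id r).mul_const t).const_add 1) hr using 1
    rw [← neg_zero, ← integral_deriv_kernel_parts hd he hr, ← integral_neg]
    refine integral_congr_ae (Filter.Eventually.of_forall fun γ => ?_)
    simp only
    rw [rpow_eq_mul_rpow_sub_one (one_add_sq_add_pos hr (inner_mem_Icc he γ))]
    ring
  obtain ⟨c, hc, h⟩ := exists_hasDerivAt_eq_slope _ _ hρ₀
    (fun r hr => (hder r ⟨by linarith [hr.1], by linarith [hr.2]⟩).continuousAt.continuousWithinAt)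
    (fun r hr => hder r ⟨by linarith [hr.1], by linarith [hr.2]⟩)
  have h' := (div_eq_zero_iff.1 h.symm).resolve_right (by linarith)
  rw [sub_eq_zero.1 h']
  simp

/-- Gauss' law: the flux of `v ↦ v / ‖v‖ ^ d` through a sphere that does not surround the origin
vanishes. The mean `K ρ` satisfies `ρ K' + (d - 1) K = 0`, so `ρ ^ (d - 1) K` is constant. -/
lemma integral_gauss_exterior (hd : 1 ≤ d) {e : EuclideanSpace ℝ (Fin d)} (he : ‖e‖ = 1)
    {ρ : ℝ} (hρ₀ : 0 < ρ) (hρ₁ : ρ < 1) :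
    ∫ γ, (ρ + inner ℝ e (γ : EuclideanSpace ℝ (Fin d))) *
      (1 + ρ ^ 2 + 2 * ρ * inner ℝ e (γ : EuclideanSpace ℝ (Fin d))) ^ (-(d : ℝ) / 2)
        ∂uniformSphere d = 0 := by
  have := isProbabilityMeasure_uniformSphere hd
  set K : ℝ → ℝ := fun ρ => ∫ γ, (ρ + inner ℝ e (γ : EuclideanSpace ℝ (Fin d))) *
      (1 + ρ ^ 2 + 2 * ρ * inner ℝ e (γ : EuclideanSpace ℝ (Fin d))) ^ (-(d : ℝ) / 2)
        ∂uniformSphere d with hK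
  have hder : ∀ r ∈ Set.Ioo (-1 : ℝ) 1, ∃ K', HasDerivAt K K' r ∧
      r * K' + (d - 1) * K r = 0 := fun r hr => by
    refine ⟨_, hasDerivAt_integral_kernel hd he (l := fun ρ t => ρ + t) (l' := fun _ t => 1)
      (by fun_prop) (by fun_prop) (fun r t => by
        simpa using (hasDerivAt_id r).add_const t) hr, ?_⟩
    have hpos := fun γ : Metric.sphere (0 : EuclideanSpace ℝ (Fin d)) 1 =>
      one_add_sq_add_pos hr (inner_mem_Icc he γ)
    have hc : ∀ p : ℝ, Continuous fun γ : Metric.sphere (0 : EuclideanSpace ℝ (Fin d)) 1 =>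
        (1 + r ^ 2 + 2 * r * inner ℝ e (γ : EuclideanSpace ℝ (Fin d))) ^ p := fun p =>
      Continuous.rpow_const (by fun_prop) fun γ => Or.inl (hpos γ).ne'
    have h2 := hc (-(d : ℝ) / 2)
    have h3 := hc (-(d : ℝ) / 2 - 1)
    rw [hK, ← integral_const_mul, ← integral_const_mul, ← integral_add
      (integrable_of_continuous_sphere hd (by fun_prop))
      (integrable_of_continuous_sphere hd (by fun_prop)),
      ← integral_deriv_kernel_parts hd he hr]
    refine integral_congr_ae (Filter.Eventually.of_forall fun γ => ?_)
    simp only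
    rw [rpow_eq_mul_rpow_sub_one (hpos γ)]
    ring
  obtain ⟨n, rfl⟩ : ∃ n, d = n + 1 := ⟨d - 1, by omega⟩
  have hder' : ∀ r ∈ Set.Ioo (0 : ℝ) ρ, HasDerivAt (fun r => r ^ n * K r) 0 r := fun r hr => by
    obtain ⟨K', h1, h2⟩ := hder r ⟨by linarith [hr.1], by linarith [hr.2]⟩
    refine ((hasDerivAt_pow n r).mul h1).congr_deriv ?_
    have hr0 := hr.1.ne'
    -- `n - 1` is truncated at `n = 0`, where its coefficient vanishes; multiplying by `r` avoids it
    have h3 : r * (n * r ^ (n - 1) * K r + r ^ n * K') = r ^ n * (r * K' + n * K r) := by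
      rcases n with _ | n
      · simp
      · simp only [Nat.add_sub_cancel]
        ring
    have h4 : (r * K' + n * K r) = 0 := by rw [← h2]; push_cast; ring
    rw [h4, mul_zero] at h3
    exact (mul_eq_zero.1 h3).resolve_left hr0
  obtain ⟨c, hc, h⟩ := exists_hasDerivAt_eq_slope _ _ hρ₀
    (fun r hr => by
      obtain ⟨K', h1, -⟩ := hder r ⟨by linarith [hr.1], by linarith [hr.2]⟩
      exact ((hasDerivAt_pow n r).mul h1).continuousAt.continuousWithinAt) hder'
  have h' := (div_eq_zero_iff.1 h.symm).resolve_right (by linarith)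
  have hK0 : K 0 = 0 := by
    simp only [hK]
    simpa using integral_inner_uniformSphere e
  rw [hK0, mul_zero, sub_zero] at h'
  exact (mul_eq_zero.1 h').resolve_left (pow_pos hρ₀ n).ne'

/-- The Poisson kernel of the unit ball has mean `1`: `1 - ρ² = (1 + ρt) - ρ (ρ + t)` splits it
into the two fluxes computed by Gauss' law. -/
lemma integral_poisson (hd : 1 ≤ d) {e : EuclideanSpace ℝ (Fin d)} (he : ‖e‖ = 1)
    {ρ : ℝ} (hρ₀ : 0 < ρ) (hρ₁ : ρ < 1) :
    ∫ γ, (1 + ρ ^ 2 + 2 * ρ * inner ℝ e (γ : EuclideanSpace ℝ (Fin d))) ^ (-(d : ℝ) / 2)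
        ∂uniformSphere d = (1 - ρ ^ 2)⁻¹ := by
  have hc : Continuous fun γ : Metric.sphere (0 : EuclideanSpace ℝ (Fin d)) 1 =>
      (1 + ρ ^ 2 + 2 * ρ * inner ℝ e (γ : EuclideanSpace ℝ (Fin d))) ^ (-(d : ℝ) / 2) :=
    Continuous.rpow_const (by fun_prop) fun γ =>
      Or.inl (one_add_sq_add_pos ⟨by linarith, hρ₁⟩ (inner_mem_Icc he γ)).ne'
  have h : ∫ γ, (1 - ρ ^ 2) *
      (1 + ρ ^ 2 + 2 * ρ * inner ℝ e (γ : EuclideanSpace ℝ (Fin d))) ^ (-(d : ℝ) / 2)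
        ∂uniformSphere d = 1 - ρ * 0 := by
    refine Eq.trans ?_ (congrArg₂ (fun a b => a - ρ * b) (integral_gauss_interior hd he hρ₀ hρ₁)
      (integral_gauss_exterior hd he hρ₀ hρ₁))
    rw [← integral_const_mul, ← integral_sub (integrable_of_continuous_sphere hd (by fun_prop))
        (integrable_of_continuous_sphere hd (by fun_prop))]
    refine integral_congr_ae (Filter.Eventually.of_forall fun γ => ?_)
    simp only
    ring
  rw [integral_const_mul, mul_zero, sub_zero] at h
  exact eq_inv_of_mul_eq_one_right h

/-- Mean value of `v ↦ ‖v‖ ^ (-d)` over the sphere of radius `r < ‖w‖` around `w`. -/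
lemma integral_norm_add_smul_pow_inv (hd : 1 ≤ d) {w : EuclideanSpace ℝ (Fin d)} {r : ℝ}
    (hr : 0 < r) (hw : r < ‖w‖) :
    ∫ γ, (‖w + r • (γ : EuclideanSpace ℝ (Fin d))‖ ^ d)⁻¹ ∂uniformSphere d =
      (‖w‖ ^ d)⁻¹ * (1 - (r / ‖w‖) ^ 2)⁻¹ := by
  have hR : 0 < ‖w‖ := hr.trans hw
  have he : ‖(‖w‖⁻¹ • w)‖ = 1 := by
    rw [norm_smul, norm_inv, norm_norm, inv_mul_cancel₀ hR.ne']
  rw [← integral_poisson hd he (div_pos hr hR) ((div_lt_one hR).2 hw), ← integral_const_mul]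
  refine integral_congr_ae (Filter.Eventually.of_forall fun γ => ?_)
  have hsq : ‖w + r • (γ : EuclideanSpace ℝ (Fin d))‖ ^ 2 = ‖w‖ ^ 2 *
      (1 + (r / ‖w‖) ^ 2 +
        2 * (r / ‖w‖) * inner ℝ (‖w‖⁻¹ • w) (γ : EuclideanSpace ℝ (Fin d))) := by
    rw [norm_add_sq_real, norm_smul, norm_eq_of_mem_sphere γ, inner_smul_right, inner_smul_left,
      Real.norm_eq_abs, mul_one, sq_abs]
    simp only [conj_trivial]
    field_simp
    ring
  have key : ∀ x : ℝ, 0 ≤ x → (x ^ d)⁻¹ = (x ^ 2) ^ (-(d : ℝ) / 2) := fun x hx => by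
    rw [← Real.rpow_natCast x 2, ← Real.rpow_mul hx, ← Real.rpow_natCast, ← Real.rpow_neg hx]
    congr 1
    push_cast
    ring
  simp only
  rw [key _ (norm_nonneg _), key _ hR.le, hsq, Real.mul_rpow (sq_nonneg _)]
  exact (one_add_sq_add_pos ⟨by linarith [div_pos hr hR], (div_lt_one hR).2 hw⟩
    (inner_mem_Icc he γ)).le

end Poisson

/-! ### Distance to the boundary -/

section Geometry

variable {d : ℕ} {D : Set (EuclideanSpace ℝ (Fin d))}

lemma frontier_nonempty (hd : 1 ≤ d) (hball : D ⊆ Metric.ball 0 1)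
    {y : EuclideanSpace ℝ (Fin d)} (hy : y ∈ D) : (frontier D).Nonempty := by
  have : Nonempty (Fin d) := ⟨⟨0, hd⟩⟩
  refine nonempty_frontier_iff.2 ⟨⟨y, hy⟩, fun h => ?_⟩
  exact NormedSpace.unbounded_univ ℝ (EuclideanSpace ℝ (Fin d))
    (h ▸ Metric.isBounded_ball.subset hball)

lemma bdist_pos (hd : 1 ≤ d) (hopen : IsOpen D) (hball : D ⊆ Metric.ball 0 1)
    {y : EuclideanSpace ℝ (Fin d)} (hy : y ∈ D) : 0 < bdist D y := by
  refine (isClosed_frontier.notMem_iff_infDist_pos (frontier_nonempty hd hball hy)).1 fun h => ?_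
  rw [hopen.frontier_eq] at h
  exact h.2 hy

lemma ball_bdist_subset (hopen : IsOpen D) {y : EuclideanSpace ℝ (Fin d)} (hy : y ∈ D) :
    Metric.ball y (bdist D y) ⊆ D := by
  intro z hz
  by_contra hzD
  have hpos : 0 < bdist D y := dist_nonneg.trans_lt hz
  have hfr : ∀ w ∈ Metric.ball y (bdist D y), w ∉ frontier D := fun w hw =>
    Metric.notMem_of_dist_lt_infDist (by rw [dist_comm]; exact hw)
  have hcl : ∀ w ∈ Metric.ball y (bdist D y), w ∉ D → w ∉ closure D := fun w hw hwD hwc =>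
    hfr w hw (hopen.frontier_eq ▸ ⟨hwc, hwD⟩)
  obtain ⟨w, -, hw, hw'⟩ := (convex_ball y (bdist D y)).isPreconnected D (closure D)ᶜ hopen
    isClosed_closure.isOpen_compl (fun w hw => or_iff_not_imp_left.2 (hcl w hw))
    ⟨y, Metric.mem_ball_self hpos, hy⟩ ⟨z, hz, hcl z hz hzD⟩
  exact hw' (subset_closure hw)

lemma bdist_le_dist (hopen : IsOpen D) {y p : EuclideanSpace ℝ (Fin d)} (hy : y ∈ D) (hp : p ∉ D) :
    bdist D y ≤ dist p y := by
  by_contra! h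
  exact hp (ball_bdist_subset hopen hy h)

lemma exists_frontier_dist_eq_bdist (hd : 1 ≤ d) (hball : D ⊆ Metric.ball 0 1)
    {y : EuclideanSpace ℝ (Fin d)} (hy : y ∈ D) : ∃ x ∈ frontier D, dist y x = bdist D y := by
  obtain ⟨x, hx, h⟩ := isClosed_frontier.exists_infDist_eq_dist
    (frontier_nonempty hd hball hy) y
  exact ⟨x, hx, h.symm⟩

end Geometry

/-! ### The extremal measure -/

section Extremal

variable {d : ℕ} {D : Set (EuclideanSpace ℝ (Fin d))}

/-- Lebesgue measure normalized so that a ball of radius `r` has measure `r ^ d`. -/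
noncomputable def ballMeasure (d : ℕ) : Measure (EuclideanSpace ℝ (Fin d)) :=
  (volume (Metric.ball (0 : EuclideanSpace ℝ (Fin d)) 1))⁻¹ • volume

/-- The largest admissible measure: normalized Lebesgue measure on `closedBall 0 2 \ D`. -/
noncomputable def extremalMeasure (D : Set (EuclideanSpace ℝ (Fin d))) :
    Measure (EuclideanSpace ℝ (Fin d)) :=
  (ballMeasure d).restrict (Metric.closedBall 0 2 \ D)

instance isAddHaarMeasure_ballMeasure : (ballMeasure d).IsAddHaarMeasure :=
  Measure.IsAddHaarMeasure.smul _
    (ENNReal.inv_ne_zero.2 Metric.isBounded_ball.measure_lt_top.ne)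
    (ENNReal.inv_ne_top.2 (Metric.measure_ball_pos _ _ one_pos).ne')

lemma ballMeasure_ball (x : EuclideanSpace ℝ (Fin d)) {r : ℝ} (hr : 0 < r) :
    ballMeasure d (Metric.ball x r) = ENNReal.ofReal (r ^ d) := by
  rw [Measure.addHaar_ball_of_pos _ _ hr]
  simp only [finrank_euclideanSpace, Fintype.card_fin, ballMeasure, Measure.smul_apply,
    smul_eq_mul]
  rw [ENNReal.inv_mul_cancel (Metric.measure_ball_pos _ _ one_pos).ne'
    Metric.isBounded_ball.measure_lt_top.ne, mul_one]

lemma ballMeasure_closedBall (x : EuclideanSpace ℝ (Fin d)) {r : ℝ} (hr : 0 < r) :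
    ballMeasure d (Metric.closedBall x r) = ENNReal.ofReal (r ^ d) := by
  rw [Measure.addHaar_closedBall _ _ hr.le, ← Measure.addHaar_ball_of_pos _ x hr,
    ballMeasure_ball x hr]

instance isFiniteMeasure_extremalMeasure : IsFiniteMeasure (extremalMeasure D) := by
  refine ⟨?_⟩
  rw [extremalMeasure, Measure.restrict_apply_univ]
  exact (Metric.isBounded_closedBall.subset Set.sdiff_subset).measure_lt_top

lemma ae_notMem_extremalMeasure (hopen : IsOpen D) : ∀ᵐ p ∂extremalMeasure D, p ∉ D := by
  filter_upwards [ae_restrict_mem (Metric.isClosed_closedBall.measurableSet.diff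
    hopen.measurableSet)] with p hp using hp.2

lemma isFiniteMeasure_of_mem_admissible {μ : Measure (EuclideanSpace ℝ (Fin d))}
    (hμ : μ ∈ admissible D) : IsFiniteMeasure μ := by
  refine ⟨?_⟩
  have h : μ (Metric.closedBall 0 2 \ D) < ∞ :=
    calc μ (Metric.closedBall 0 2 \ D) ≤ μ (Metric.ball 0 3) :=
          measure_mono (Set.sdiff_subset.trans (Metric.closedBall_subset_ball (by norm_num)))
      _ ≤ _ := hμ.2 0 3 (by norm_num)
      _ < ∞ := ENNReal.ofReal_lt_top
  rw [← Set.union_compl_self (Metric.closedBall 0 2 \ D)]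
  refine (measure_union_le _ _).trans_lt ?_
  rw [hμ.1, add_zero]
  exact h

lemma closedBall_le_of_mem_admissible {μ : Measure (EuclideanSpace ℝ (Fin d))}
    (hμ : μ ∈ admissible D) (x : EuclideanSpace ℝ (Fin d)) {r : ℝ} (hr : 0 < r) :
    μ (Metric.closedBall x r) ≤ ENNReal.ofReal (r ^ d) := by
  have ht : Filter.Tendsto (fun t : ℝ => ENNReal.ofReal (t ^ d)) (nhdsWithin r (Set.Ioi r))
      (nhds (ENNReal.ofReal (r ^ d))) :=
    ((ENNReal.continuous_ofReal.comp (continuous_pow d)).tendsto r).mono_left nhdsWithin_le_nhds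
  refine ge_of_tendsto ht ?_
  filter_upwards [self_mem_nhdsWithin] with t htr
  exact (measure_mono (Metric.closedBall_subset_ball htr)).trans (hμ.2 x t (hr.trans htr))

/-- The growth condition in dimension `d` forces domination by the normalized Lebesgue measure, by
the Besicovitch covering theorem. Hence the supremum in the definition of the energy is attained
simultaneously at all points. -/
lemma le_extremalMeasure {μ : Measure (EuclideanSpace ℝ (Fin d))} (hopen : IsOpen D)
    (hμ : μ ∈ admissible D) : μ ≤ extremalMeasure D := by
  have := isFiniteMeasure_of_mem_admissible hμ
  have hle : ∀ s, μ s ≤ ballMeasure d s := fun s => by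
    refine (Besicovitch.vitaliFamily μ).measure_le_of_frequently_le (ballMeasure d)
      Measure.AbsolutelyContinuous.rfl s fun x _ => ?_
    refine (Besicovitch.tendsto_filterAt μ x).frequently (Filter.Eventually.frequently ?_)
    filter_upwards [self_mem_nhdsWithin] with r hr
    rw [ballMeasure_closedBall x hr]
    exact closedBall_le_of_mem_admissible hμ x hr
  have hK : MeasurableSet (Metric.closedBall 0 2 \ D) :=
    Metric.isClosed_closedBall.measurableSet.diff hopen.measurableSet
  refine Measure.le_iff.2 fun s hs => ?_
  rw [extremalMeasure, Measure.restrict_apply hs, ← measure_inter_add_sdiff s hK]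
  have h0 : μ (s \ (Metric.closedBall 0 2 \ D)) = 0 :=
    measure_mono_null (fun x hx => hx.2) hμ.1
  rw [h0, add_zero]
  exact hle _

lemma extremalMeasure_ball_le (x : EuclideanSpace ℝ (Fin d)) {r : ℝ} (hr : 0 < r) :
    extremalMeasure D (Metric.ball x r) ≤ ENNReal.ofReal (r ^ d) :=
  (Measure.restrict_apply_le _ _).trans (ballMeasure_ball x hr).le

lemma extremalMeasure_mem_admissible (hopen : IsOpen D) : extremalMeasure D ∈ admissible D := by
  refine ⟨?_, fun x r hr => extremalMeasure_ball_le x hr⟩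
  have hK : MeasurableSet (Metric.closedBall 0 2 \ D) :=
    Metric.isClosed_closedBall.measurableSet.diff hopen.measurableSet
  rw [extremalMeasure, Measure.restrict_apply hK.compl, Set.compl_inter_self, measure_empty]

lemma energy_eq_rieszPotential (hopen : IsOpen D) (x : EuclideanSpace ℝ (Fin d)) :
    energy D x = rieszPotential (extremalMeasure D) x := by
  refine le_antisymm (iSup₂_le fun μ hμ => ?_)
    (le_iSup₂_of_le (extremalMeasure D) (extremalMeasure_mem_admissible hopen) le_rfl)
  exact lintegral_mono fun r => ENNReal.div_le_div_right (le_extremalMeasure hopen hμ _) _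

/-- The ball around a point of `D` with radius the distance to the boundary is contained in the
unit ball. -/
lemma bdist_le_one (hd : 1 ≤ d) (hopen : IsOpen D) (hball : D ⊆ Metric.ball 0 1)
    {y : EuclideanSpace ℝ (Fin d)} (hy : y ∈ D) : bdist D y ≤ 1 := by
  have hpos := bdist_pos hd hopen hball hy
  have h : ballMeasure d (Metric.ball y (bdist D y)) ≤ ballMeasure d (Metric.ball 0 1) :=
    measure_mono ((ball_bdist_subset hopen hy).trans hball)
  rw [ballMeasure_ball _ hpos, ballMeasure_ball _ one_pos, one_pow,
    ENNReal.ofReal_le_ofReal_iff zero_le_one] at h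
  exact (pow_le_one_iff_of_nonneg hpos.le (by omega)).1 h

lemma hausdorffContent_le_hausdorffMeasure {s : ℝ} (S : Set (EuclideanSpace ℝ (Fin d))) :
    hausdorffContent s S ≤ Measure.hausdorffMeasure s S := by
  rw [Measure.hausdorffMeasure_apply]
  refine le_trans ?_ (le_iSup₂ (∞ : ℝ≥0∞) ENNReal.zero_lt_top)
  refine le_iInf₂ fun t ht => le_iInf fun _ => ?_
  exact iInf₂_le t ht

/-- Thickness in terms of the extremal measure: in dimension `d` the Hausdorff content is
dominated by a multiple of Lebesgue measure. -/
lemma exists_le_extremalMeasure_ball (hball : D ⊆ Metric.ball 0 1) (hthick : IsZeroThick D) :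
    ∃ c : ℝ, 0 < c ∧ ∀ x ∈ frontier D, ∀ r : ℝ, 0 < r → r < 1 →
      ENNReal.ofReal (c * r ^ d) ≤ extremalMeasure D (Metric.ball x r) := by
  obtain ⟨C, hC, h⟩ := hthick
  have hH : (Measure.hausdorffMeasure (d : ℝ) :
      Measure (EuclideanSpace ℝ (Fin d))).IsAddHaarMeasure := by
    simpa using isAddHaarMeasure_hausdorffMeasure (E := EuclideanSpace ℝ (Fin d))
  have hk := Measure.isAddLeftInvariant_eq_smul
    (Measure.hausdorffMeasure (d : ℝ) : Measure (EuclideanSpace ℝ (Fin d))) (ballMeasure d)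
  have hkpos := Measure.addHaarScalarFactor_pos_of_isAddHaarMeasure
    (Measure.hausdorffMeasure (d : ℝ) : Measure (EuclideanSpace ℝ (Fin d))) (ballMeasure d)
  set k := Measure.addHaarScalarFactor
    (Measure.hausdorffMeasure (d : ℝ) : Measure (EuclideanSpace ℝ (Fin d))) (ballMeasure d)
  have hk0 : (k : ℝ≥0∞) ≠ 0 := by exact_mod_cast hkpos.ne'
  refine ⟨C / k, div_pos hC (by exact_mod_cast hkpos), fun x hx r hr hr1 => ?_⟩
  have hsub : Metric.ball x r \ D ⊆ Metric.ball x r ∩ (Metric.closedBall 0 2 \ D) := by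
    rintro z ⟨hz, hzD⟩
    refine ⟨hz, ?_, hzD⟩
    have h1 : x ∈ Metric.closedBall (0 : EuclideanSpace ℝ (Fin d)) 1 :=
      (closure_mono hball).trans Metric.closure_ball_subset_closedBall (frontier_subset_closure hx)
    rw [Metric.mem_closedBall] at h1 ⊢
    have h2 := dist_triangle z x 0
    have h3 : dist z x < r := hz
    linarith
  calc ENNReal.ofReal (C / k * r ^ d)
      = ENNReal.ofReal (C * r ^ d) / k := by
        rw [div_mul_eq_mul_div, ENNReal.ofReal_div_of_pos (by exact_mod_cast hkpos),
          ENNReal.ofReal_coe_nnreal]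
    _ ≤ (k * ballMeasure d (Metric.ball x r \ D)) / k := by
        refine ENNReal.div_le_div_right ?_ _
        refine (h x hx r hr hr1).trans ((hausdorffContent_le_hausdorffMeasure _).trans ?_)
        rw [hk, Measure.smul_apply, ENNReal.smul_def, smul_eq_mul]
    _ = ballMeasure d (Metric.ball x r \ D) := by
        rw [mul_comm, ENNReal.mul_div_cancel_right hk0 ENNReal.coe_ne_top]
    _ ≤ extremalMeasure D (Metric.ball x r) := by
        rw [extremalMeasure, Measure.restrict_apply Metric.isOpen_ball.measurableSet]
        exact measure_mono hsub

end Extremal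

/-! ### Riesz potentials as integrals of the Riesz kernel -/

section Kernel

variable {d : ℕ} {D : Set (EuclideanSpace ℝ (Fin d))}

lemma lintegral_Ioi_inv_pow {k : ℕ} (hk : 1 ≤ k) {a : ℝ} (ha : 0 < a) :
    ∫⁻ r in Set.Ioi a, (ENNReal.ofReal (r ^ (k + 1)))⁻¹ = ENNReal.ofReal ((a ^ k)⁻¹ / k) := by
  have hk' : (-(k + 1 : ℕ) : ℝ) < -1 := by
    have : (1 : ℝ) ≤ k := by exact_mod_cast hk
    push_cast
    linarith
  have h1 : ∫⁻ r in Set.Ioi a, (ENNReal.ofReal (r ^ (k + 1)))⁻¹ =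
      ∫⁻ r in Set.Ioi a, ENNReal.ofReal (r ^ (-(k + 1 : ℕ) : ℝ)) := by
    refine setLIntegral_congr_fun measurableSet_Ioi fun r hr => ?_
    have hr0 : 0 < r := ha.trans hr
    rw [← ENNReal.ofReal_inv_of_pos (pow_pos hr0 _), Real.rpow_neg hr0.le, Real.rpow_natCast]
  rw [h1, ← ofReal_integral_eq_lintegral_ofReal (integrableOn_Ioi_rpow_of_lt hk' ha),
    integral_Ioi_rpow_of_lt hk' ha]
  · congr 1
    have : (-(k + 1 : ℕ) : ℝ) + 1 = -(k : ℝ) := by push_cast; ring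
    rw [this, Real.rpow_neg ha.le, Real.rpow_natCast, neg_div_neg_eq]
  · filter_upwards [ae_restrict_mem measurableSet_Ioi] with r hr
    exact Real.rpow_nonneg (ha.trans hr).le _

/-- Layer-cake formula for the Riesz kernels. -/
lemma lintegral_ball_div_pow (μ : Measure (EuclideanSpace ℝ (Fin d))) [SFinite μ] {k : ℕ}
    (hk : 1 ≤ k) {x : EuclideanSpace ℝ (Fin d)} (hx : ∀ᵐ p ∂μ, p ≠ x) :
    ∫⁻ r in Set.Ioi (0 : ℝ), μ (Metric.ball x r) / ENNReal.ofReal (r ^ (k + 1)) =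
      ∫⁻ p, ENNReal.ofReal ((dist p x ^ k)⁻¹ / k) ∂μ := by
  have hm : MeasurableSet {q : ℝ × EuclideanSpace ℝ (Fin d) | dist q.2 x < q.1} :=
    measurableSet_lt (by fun_prop) (by fun_prop)
  have h1 : ∀ r : ℝ, μ (Metric.ball x r) / ENNReal.ofReal (r ^ (k + 1)) =
      ∫⁻ p, {q : ℝ × EuclideanSpace ℝ (Fin d) | dist q.2 x < q.1}.indicator
        (fun q => (ENNReal.ofReal (q.1 ^ (k + 1)))⁻¹) (r, p) ∂μ := fun r => by
    have : (fun p => {q : ℝ × EuclideanSpace ℝ (Fin d) | dist q.2 x < q.1}.indicator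
        (fun q => (ENNReal.ofReal (q.1 ^ (k + 1)))⁻¹) (r, p)) =
        (Metric.ball x r).indicator fun _ => (ENNReal.ofReal (r ^ (k + 1)))⁻¹ := by
      ext p
      simp only [Set.indicator, Set.mem_ofPred_eq, Metric.mem_ball]
    rw [this, lintegral_indicator_const Metric.isOpen_ball.measurableSet, mul_comm]
    rfl
  simp only [h1]
  rw [lintegral_lintegral_swap]
  · refine lintegral_congr_ae ?_
    filter_upwards [hx] with p hp
    have hpos : 0 < dist p x := dist_pos.2 hp
    rw [← lintegral_Ioi_inv_pow hk hpos]
    have : (fun r : ℝ => {q : ℝ × EuclideanSpace ℝ (Fin d) | dist q.2 x < q.1}.indicator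
        (fun q => (ENNReal.ofReal (q.1 ^ (k + 1)))⁻¹) (r, p)) =
        (Set.Ioi (dist p x)).indicator fun r => (ENNReal.ofReal (r ^ (k + 1)))⁻¹ := by
      ext r
      simp only [Set.indicator, Set.mem_ofPred_eq, Set.mem_Ioi]
    rw [this, lintegral_indicator measurableSet_Ioi, Measure.restrict_restrict measurableSet_Ioi,
      Set.inter_eq_left.2 (Set.Ioi_subset_Ioi hpos.le)]
  · exact (Measurable.indicator (by fun_prop) hm).aemeasurable

lemma ae_bdist_le_dist (hopen : IsOpen D) {y : EuclideanSpace ℝ (Fin d)} (hy : y ∈ D) :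
    ∀ᵐ p ∂extremalMeasure D, bdist D y ≤ dist p y := by
  filter_upwards [ae_notMem_extremalMeasure hopen] with p hp using bdist_le_dist hopen hy hp

lemma integrable_dist_pow_inv (hd : 1 ≤ d) (hopen : IsOpen D) (hball : D ⊆ Metric.ball 0 1)
    {y : EuclideanSpace ℝ (Fin d)} (hy : y ∈ D) (k : ℕ) :
    Integrable (fun p => (dist p y ^ k)⁻¹) (extremalMeasure D) := by
  have hpos := bdist_pos hd hopen hball hy
  refine Integrable.of_bound (C := (bdist D y ^ k)⁻¹)
    (by fun_prop : Measurable fun p => (dist p y ^ k)⁻¹).aestronglyMeasurable ?_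
  filter_upwards [ae_bdist_le_dist hopen hy] with p hp
  rw [Real.norm_of_nonneg (by positivity)]
  gcongr

/-- On `D`, the energy is the potential of the extremal measure with respect to the Riesz kernel
`|x - p| ^ (-d) / d`. -/
lemma energy_eq_ofReal_integral (hd : 1 ≤ d) (hopen : IsOpen D) (hball : D ⊆ Metric.ball 0 1)
    {y : EuclideanSpace ℝ (Fin d)} (hy : y ∈ D) :
    energy D y = ENNReal.ofReal (∫ p, (dist p y ^ d)⁻¹ / d ∂extremalMeasure D) := by
  rw [energy_eq_rieszPotential hopen, rieszPotential, lintegral_ball_div_pow _ hd,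
    ofReal_integral_eq_lintegral_ofReal]
  · exact (integrable_dist_pow_inv hd hopen hball hy d).div_const _
  · exact Filter.Eventually.of_forall fun p => by positivity
  · filter_upwards [ae_notMem_extremalMeasure hopen] with p hp h
    exact hp (h ▸ hy)

lemma toReal_energy_eq_integral (hd : 1 ≤ d) (hopen : IsOpen D) (hball : D ⊆ Metric.ball 0 1)
    {y : EuclideanSpace ℝ (Fin d)} (hy : y ∈ D) :
    (energy D y).toReal = ∫ p, (dist p y ^ d)⁻¹ / d ∂extremalMeasure D := by
  rw [energy_eq_ofReal_integral hd hopen hball hy, ENNReal.toReal_ofReal]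
  exact integral_nonneg fun p => by positivity

lemma measurable_energy (hopen : IsOpen D) : Measurable (energy D) := by
  have h : energy D = fun x => ∫⁻ r in Set.Ioi (0 : ℝ),
      extremalMeasure D (Metric.ball x r) / ENNReal.ofReal (r ^ (d + 1)) :=
    funext fun x => energy_eq_rieszPotential hopen x
  rw [h]
  have hm : MeasurableSet {q : (EuclideanSpace ℝ (Fin d) × ℝ) × EuclideanSpace ℝ (Fin d) |
      dist q.2 q.1.1 < q.1.2} := measurableSet_lt (by fun_prop) (by fun_prop)
  have h1 : Measurable fun q : EuclideanSpace ℝ (Fin d) × ℝ =>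
      extremalMeasure D (Metric.ball q.1 q.2) := measurable_measure_prodMk_left hm
  exact Measurable.lintegral_prod_right' (f := fun q : EuclideanSpace ℝ (Fin d) × ℝ =>
    extremalMeasure D (Metric.ball q.1 q.2) / ENNReal.ofReal (q.2 ^ (d + 1)))
    (h1.div (by fun_prop))

/-- The layer-cake formula with exponent `d + 1`, combined with the growth of order `r ^ d` and the
vanishing of the mass of small balls around a point of `D`. -/
lemma integral_dist_pow_succ_inv_le (hd : 1 ≤ d) (hopen : IsOpen D)
    (hball : D ⊆ Metric.ball 0 1) {y : EuclideanSpace ℝ (Fin d)} (hy : y ∈ D) :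
    ∫ p, (dist p y ^ (d + 1))⁻¹ ∂extremalMeasure D ≤ (d + 1) / bdist D y := by
  have hpos := bdist_pos hd hopen hball hy
  have hne : ∀ᵐ p ∂extremalMeasure D, p ≠ y := by
    filter_upwards [ae_notMem_extremalMeasure hopen] with p hp h
    exact hp (h ▸ hy)
  have hzero : ∀ r, r ≤ bdist D y → extremalMeasure D (Metric.ball y r) = 0 := fun r hr => by
    refine measure_mono_null ?_ (ae_notMem_extremalMeasure hopen)
    exact fun z hz hzD => hzD (ball_bdist_subset hopen hy (Metric.ball_subset_ball hr hz))
  have h : ∫⁻ p, ENNReal.ofReal ((dist p y ^ (d + 1))⁻¹ / (d + 1 : ℕ)) ∂extremalMeasure D ≤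
      ENNReal.ofReal (1 / bdist D y) := by
    rw [← lintegral_ball_div_pow _ (by omega) hne]
    calc ∫⁻ r in Set.Ioi (0 : ℝ), extremalMeasure D (Metric.ball y r) /
          ENNReal.ofReal (r ^ (d + 1 + 1))
        ≤ ∫⁻ r in Set.Ioi (0 : ℝ), (Set.Ioi (bdist D y)).indicator
          (fun r => (ENNReal.ofReal (r ^ (1 + 1)))⁻¹) r := by
          refine setLIntegral_mono' measurableSet_Ioi fun r hr => ?_
          have hr0 : 0 < r := hr
          by_cases hrb : bdist D y < r
          · rw [Set.indicator_of_mem (Set.mem_Ioi.2 hrb)]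
            refine (ENNReal.div_le_div_right (extremalMeasure_ball_le y hr0) _).trans ?_
            rw [← ENNReal.ofReal_div_of_pos (by positivity),
              ← ENNReal.ofReal_inv_of_pos (by positivity)]
            refine ENNReal.ofReal_le_ofReal (le_of_eq ?_)
            field_simp
            ring
          · rw [hzero r (not_lt.1 hrb), ENNReal.zero_div]
            exact zero_le
      _ = ENNReal.ofReal (1 / bdist D y) := by
          rw [lintegral_indicator measurableSet_Ioi, Measure.restrict_restrict measurableSet_Ioi,
            Set.inter_eq_left.2 (Set.Ioi_subset_Ioi hpos.le), lintegral_Ioi_inv_pow le_rfl hpos]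
          simp
  rw [← ofReal_integral_eq_lintegral_ofReal
    ((integrable_dist_pow_inv hd hopen hball hy _).div_const _)
    (Filter.Eventually.of_forall fun p => by positivity),
    ENNReal.ofReal_le_ofReal_iff (by positivity), integral_div, div_le_iff₀ (by positivity)] at h
  refine h.trans (le_of_eq ?_)
  push_cast
  ring

end Kernel

/-! ### The Binder–Braverman alternative -/

section Alternative

variable {d : ℕ} {D : Set (EuclideanSpace ℝ (Fin d))}

lemma lintegral_Ioc_ofReal_const_div {κ a b : ℝ} (hκ : 0 ≤ κ) (ha : 0 < a) (hab : a ≤ b) :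
    ∫⁻ r in Set.Ioc a b, ENNReal.ofReal (κ / r) = ENNReal.ofReal (κ * Real.log (b / a)) := by
  have hint : IntegrableOn (fun r => κ / r) (Set.Ioc a b) := by
    refine (ContinuousOn.integrableOn_Icc ?_).mono_set Set.Ioc_subset_Icc_self
    exact continuousOn_const.div continuousOn_id fun r hr => (ha.trans_le hr.1).ne'
  rw [← ofReal_integral_eq_lintegral_ofReal hint, ← intervalIntegral.integral_of_le hab]
  · congr 1
    simp only [div_eq_mul_inv κ]
    rw [intervalIntegral.integral_const_mul, integral_inv_of_pos ha (ha.trans_le hab)]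
  · filter_upwards [ae_restrict_mem measurableSet_Ioc] with r hr
    exact div_nonneg hκ (ha.trans hr.1).le

/-- A surplus of mass `κ r ^ d` at all scales `r ∈ (a, b]` increases the potential by
`κ log (b / a)`. -/
lemma rieszPotential_add_log_le {μ ν : Measure (EuclideanSpace ℝ (Fin d))} (hle : μ ≤ ν)
    {z : EuclideanSpace ℝ (Fin d)} {κ a b : ℝ} (hκ : 0 ≤ κ) (ha : 0 < a) (hab : a ≤ b)
    (h : ∀ r, a < r → r ≤ b → μ (Metric.ball z r) + ENNReal.ofReal (κ * r ^ d) ≤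
      ν (Metric.ball z r)) :
    rieszPotential μ z + ENNReal.ofReal (κ * Real.log (b / a)) ≤ rieszPotential ν z := by
  have hind : ∫⁻ r in Set.Ioi (0 : ℝ), (Set.Ioc a b).indicator
      (fun r => ENNReal.ofReal (κ / r)) r = ENNReal.ofReal (κ * Real.log (b / a)) := by
    rw [lintegral_indicator measurableSet_Ioc, Measure.restrict_restrict measurableSet_Ioc,
      Set.inter_eq_left.2, lintegral_Ioc_ofReal_const_div hκ ha hab]
    exact fun r hr => ha.trans hr.1
  rw [← hind, rieszPotential, rieszPotential,
    ← lintegral_add_right _ ((by fun_prop : Measurable fun r : ℝ =>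
      ENNReal.ofReal (κ / r)).indicator measurableSet_Ioc)]
  refine setLIntegral_mono_ae' measurableSet_Ioi (Filter.Eventually.of_forall fun r hr => ?_)
  have hr0 : 0 < r := hr
  by_cases hm : r ∈ Set.Ioc a b
  · rw [Set.indicator_of_mem hm]
    have : ENNReal.ofReal (κ / r) = ENNReal.ofReal (κ * r ^ d) / ENNReal.ofReal (r ^ (d + 1)) := by
      rw [← ENNReal.ofReal_div_of_pos (by positivity)]
      congr 1
      field_simp
      ring
    rw [this, ← ENNReal.add_div]
    exact ENNReal.div_le_div_right (h r hm.1 hm.2) _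
  · rw [Set.indicator_of_notMem hm, add_zero]
    exact ENNReal.div_le_div_right (hle _) _

/-- Near a boundary point `x`, thickness gives the extremal measure mass of order `r ^ d` at all
scales `r` between `2δ d(y)` and `d(y) / 2`. A measure with little mass in `B(y, 2 d(y))` misses a
fixed proportion of it, and the potential of the difference is of order `log (1 / (4δ))`. -/
lemma exists_isBinderBravermanPair (hd : 1 ≤ d) (hopen : IsOpen D) (hball : D ⊆ Metric.ball 0 1)
    (hthick : IsZeroThick D) : ∃ δ η : ℝ, δ < 2 ∧ IsBinderBravermanPair D δ η := by
  obtain ⟨c, hc, hthick⟩ := exists_le_extremalMeasure_ball hball hthick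
  set κ : ℝ := c * (1 / 2) ^ (d + 1) with hκ
  have hκ0 : 0 < κ := by positivity
  -- chosen so that `κ log (1 / (4δ)) = κ + 1`
  set δ : ℝ := Real.exp (-(1 + 1 / κ)) / 4 with hδ
  have hδ0 : 0 < δ := by positivity
  have hexp : Real.exp (-(1 + 1 / κ)) < 1 := by
    rw [Real.exp_lt_one_iff]
    have : 0 < 1 / κ := by positivity
    linarith
  have hδ1 : 4 * δ < 1 := by rw [hδ]; linarith
  refine ⟨δ, κ * (2 * δ) ^ d, by linarith, hδ0, by positivity, ?_⟩
  intro y hy x hx hyx μ hμ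
  refine or_iff_not_imp_right.2 fun hlow z hz hzx _ => ?_
  rw [not_le] at hlow
  set s := bdist D y with hs
  have hs0 : 0 < s := bdist_pos hd hopen hball hy
  have hs1 : s ≤ 1 := bdist_le_one hd hopen hball hy
  have hle := le_extremalMeasure hopen hμ
  have hgain := rieszPotential_add_log_le hle (z := z) (κ := κ) (a := 2 * δ * s) (b := s / 2)
    hκ0.le (by positivity) (by nlinarith) (fun r har hrb => by
      have hsub : μ (Metric.ball z r) ≤ ENNReal.ofReal (κ * r ^ d) := by
        have h1 : Metric.ball z r ⊆ Metric.ball y (2 * s) := fun p hp => by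
          rw [Metric.mem_ball] at hp ⊢
          have h2 := dist_triangle p z y
          have h3 := dist_triangle z x y
          rw [dist_comm x y, hyx] at h3
          nlinarith
        refine (measure_mono h1).trans (hlow.le.trans (ENNReal.ofReal_le_ofReal ?_))
        rw [mul_assoc, ← mul_pow]
        gcongr
      have hsup : ENNReal.ofReal (c * (r / 2) ^ d) ≤ extremalMeasure D (Metric.ball z r) := by
        have h1 : Metric.ball x (r / 2) ⊆ Metric.ball z r := fun p hp => by
          rw [Metric.mem_ball] at hp ⊢
          have h2 := dist_triangle p x z
          rw [dist_comm x z] at h2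
          nlinarith
        have hr0 : 0 < r := lt_trans (by positivity) har
        exact (hthick x hx (r / 2) (by linarith) (by linarith)).trans (measure_mono h1)
      refine le_trans ?_ hsup
      have hr0 : 0 < r := lt_trans (by positivity) har
      have : c * (r / 2) ^ d = κ * r ^ d + κ * r ^ d := by
        rw [hκ, pow_succ, div_pow, div_pow]
        ring
      rw [this, ENNReal.ofReal_add (by positivity) (by positivity)]
      gcongr)
  have hlog : κ * Real.log (s / 2 / (2 * δ * s)) = κ + 1 := by
    have : s / 2 / (2 * δ * s) = (4 * δ)⁻¹ := by field_simp; norm_num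
    rw [this, Real.log_inv, hδ, mul_div_cancel₀ _ (by norm_num : (4 : ℝ) ≠ 0), Real.log_exp]
    field_simp
  rw [hlog] at hgain
  rw [energy_eq_rieszPotential hopen]
  refine lt_of_lt_of_le ?_ hgain
  have hfin : rieszPotential μ z ≠ ∞ := by
    refine ne_top_of_le_ne_top ?_
      (show rieszPotential μ z ≤ energy D z from le_iSup₂_of_le μ hμ le_rfl)
    rw [energy_eq_ofReal_integral hd hopen hball hz]
    exact ENNReal.ofReal_ne_top
  refine ENNReal.add_lt_add_left hfin ?_
  rw [← ENNReal.ofReal_one]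
  exact ENNReal.ofReal_lt_ofReal_iff'.2 ⟨by linarith, by linarith⟩

end Alternative

/-! ### The drift of the energy in one step -/

section Drift

variable {d : ℕ} {D : Set (EuclideanSpace ℝ (Fin d))} {β : ℝ}

/-- One step of the walk from `y` in the direction `γ`. -/
noncomputable def walkStep (D : Set (EuclideanSpace ℝ (Fin d))) (β : ℝ)
    (y : EuclideanSpace ℝ (Fin d)) (γ : Metric.sphere (0 : EuclideanSpace ℝ (Fin d)) 1) :
    EuclideanSpace ℝ (Fin d) :=
  y + (β * bdist D y) • (γ : EuclideanSpace ℝ (Fin d))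

/-- The increment of the energy in one step of the walk. -/
noncomputable def energyIncrement (D : Set (EuclideanSpace ℝ (Fin d))) (β : ℝ)
    (y : EuclideanSpace ℝ (Fin d)) (γ : Metric.sphere (0 : EuclideanSpace ℝ (Fin d)) 1) : ℝ :=
  (energy D (walkStep D β y γ)).toReal - (energy D y).toReal

/-- The increment of the Riesz kernel with pole `p` in one step of the walk. -/
noncomputable def kernelIncrement (D : Set (EuclideanSpace ℝ (Fin d))) (β : ℝ)
    (y : EuclideanSpace ℝ (Fin d)) (γ : Metric.sphere (0 : EuclideanSpace ℝ (Fin d)) 1)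
    (p : EuclideanSpace ℝ (Fin d)) : ℝ :=
  (dist p (walkStep D β y γ) ^ d)⁻¹ / d - (dist p y ^ d)⁻¹ / d

lemma measurable_bdist : Measurable (bdist D) :=
  (Metric.continuous_infDist_pt _).measurable

lemma measurable_walkStep : Measurable fun q : EuclideanSpace ℝ (Fin d) ×
    Metric.sphere (0 : EuclideanSpace ℝ (Fin d)) 1 => walkStep D β q.1 q.2 := by
  have h := (measurable_bdist (D := D)).comp (measurable_fst : Measurable
    (Prod.fst : EuclideanSpace ℝ (Fin d) × Metric.sphere (0 : EuclideanSpace ℝ (Fin d)) 1 → _))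
  exact measurable_fst.add ((h.const_mul β).smul (measurable_subtype_coe.comp measurable_snd))

lemma measurable_energyIncrement (hopen : IsOpen D) : Measurable fun q :
    EuclideanSpace ℝ (Fin d) × Metric.sphere (0 : EuclideanSpace ℝ (Fin d)) 1 =>
      energyIncrement D β q.1 q.2 :=
  ((measurable_energy hopen).comp measurable_walkStep).ennreal_toReal.sub
    ((measurable_energy hopen).comp measurable_fst).ennreal_toReal

lemma measurable_kernelIncrement (y : EuclideanSpace ℝ (Fin d)) : Measurable fun q :
    Metric.sphere (0 : EuclideanSpace ℝ (Fin d)) 1 × EuclideanSpace ℝ (Fin d) =>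
      kernelIncrement D β y q.1 q.2 := by
  unfold kernelIncrement walkStep
  fun_prop

lemma dist_walkStep (hβ : 0 < β) (y : EuclideanSpace ℝ (Fin d))
    (γ : Metric.sphere (0 : EuclideanSpace ℝ (Fin d)) 1) :
    dist (walkStep D β y γ) y = β * bdist D y := by
  have h : 0 ≤ bdist D y := Metric.infDist_nonneg
  rw [walkStep, dist_self_add_left, norm_smul, norm_eq_of_mem_sphere γ, mul_one,
    Real.norm_of_nonneg (mul_nonneg hβ.le h)]

lemma walkStep_mem (hd : 1 ≤ d) (hopen : IsOpen D) (hball : D ⊆ Metric.ball 0 1) (hβ : 0 < β)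
    (hβ1 : β < 1) {y : EuclideanSpace ℝ (Fin d)} (hy : y ∈ D)
    (γ : Metric.sphere (0 : EuclideanSpace ℝ (Fin d)) 1) : walkStep D β y γ ∈ D := by
  refine ball_bdist_subset hopen hy ?_
  rw [Metric.mem_ball, dist_walkStep hβ]
  exact mul_lt_of_lt_one_left (bdist_pos hd hopen hball hy) hβ1

/-- The increment of the Riesz kernel decays one power faster than the kernel itself, which makes
it integrable uniformly in the starting point. -/
lemma abs_kernelIncrement_le (hβ : 0 < β) (hβ1 : β < 1) {y p : EuclideanSpace ℝ (Fin d)}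
    (hpos : 0 < bdist D y) (hp : bdist D y ≤ dist p y)
    (γ : Metric.sphere (0 : EuclideanSpace ℝ (Fin d)) 1) :
    |kernelIncrement D β y γ p| ≤
      2 ^ d / (1 - β) ^ d * bdist D y * (dist p y ^ (d + 1))⁻¹ := by
  rcases Nat.eq_zero_or_pos d with rfl | hd
  · simp only [kernelIncrement, Nat.cast_zero, div_zero, sub_zero, abs_zero]
    positivity
  set a := dist p (walkStep D β y γ) with ha
  set R := dist p y with hR
  set s := bdist D y
  have hR0 : 0 < R := hpos.trans_le hp
  have hstep : dist (walkStep D β y γ) y = β * s := dist_walkStep hβ y γ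
  have h1 : R ≤ a + β * s := hstep ▸ dist_triangle p _ y
  have h2 : a ≤ R + β * s := by
    rw [← hstep, dist_comm _ y]
    exact dist_triangle p y _
  have hβR : β * s ≤ β * R := by gcongr
  have hβs : β * s ≤ s := by nlinarith
  have haR : (1 - β) * R ≤ a := by linarith
  have hβ0 : 0 < 1 - β := by linarith
  have ha0 : 0 < a := lt_of_lt_of_le (by positivity) haR
  have hpow : |R ^ d - a ^ d| ≤ s * d * (2 * R) ^ (d - 1) := by
    refine (abs_pow_sub_pow_le R a d).trans ?_
    have h3 : |R - a| ≤ s := by rw [abs_le]; constructor <;> linarith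
    have h4 : max |R| |a| ≤ 2 * R := by
      rw [abs_of_pos hR0, abs_of_pos ha0]
      refine max_le ?_ ?_ <;> nlinarith
    have h5 : 0 ≤ max |R| |a| := (abs_nonneg _).trans (le_max_left _ _)
    gcongr
  have hd0 : (0 : ℝ) < d := by exact_mod_cast hd
  have hform : kernelIncrement D β y γ p = (R ^ d - a ^ d) / (d * (a ^ d * R ^ d)) := by
    rw [kernelIncrement, ← ha, ← hR]
    field_simp
  rw [hform, abs_div, abs_of_pos (by positivity : 0 < d * (a ^ d * R ^ d))]
  calc |R ^ d - a ^ d| / (d * (a ^ d * R ^ d))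
      ≤ (s * d * (2 * R) ^ (d - 1)) / (d * (((1 - β) * R) ^ d * R ^ d)) := by gcongr
    _ ≤ (s * d * (2 * (2 * R) ^ (d - 1))) / (d * (((1 - β) * R) ^ d * R ^ d)) := by
        have : 0 ≤ (2 * R) ^ (d - 1) := by positivity
        gcongr
        linarith
    _ = 2 ^ d / (1 - β) ^ d * s * (R ^ (d + 1))⁻¹ := by
        obtain ⟨n, rfl⟩ : ∃ n, d = n + 1 := ⟨d - 1, by omega⟩
        simp only [Nat.add_sub_cancel, mul_pow]
        field_simp
        ring

lemma energyIncrement_eq_integral (hd : 1 ≤ d) (hopen : IsOpen D) (hball : D ⊆ Metric.ball 0 1)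
    (hβ : 0 < β) (hβ1 : β < 1) {y : EuclideanSpace ℝ (Fin d)} (hy : y ∈ D)
    (γ : Metric.sphere (0 : EuclideanSpace ℝ (Fin d)) 1) :
    energyIncrement D β y γ = ∫ p, kernelIncrement D β y γ p ∂extremalMeasure D := by
  have hz := walkStep_mem hd hopen hball hβ hβ1 hy γ
  rw [energyIncrement, toReal_energy_eq_integral hd hopen hball hz,
    toReal_energy_eq_integral hd hopen hball hy, ← integral_sub]
  · rfl
  · exact (integrable_dist_pow_inv hd hopen hball hz d).div_const _
  · exact (integrable_dist_pow_inv hd hopen hball hy d).div_const _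

/-- The energy may be unbounded near the boundary, but its increments along the walk are bounded. -/
lemma exists_abs_energyIncrement_le (hd : 1 ≤ d) (hopen : IsOpen D)
    (hball : D ⊆ Metric.ball 0 1) (hβ : 0 < β) (hβ1 : β < 1) :
    ∃ C : ℝ, ∀ y ∈ D, ∀ γ, |energyIncrement D β y γ| ≤ C := by
  refine ⟨2 ^ d / (1 - β) ^ d * (d + 1), fun y hy γ => ?_⟩
  have hpos := bdist_pos hd hopen hball hy
  have hβ0 : 0 < 1 - β := by linarith
  rw [energyIncrement_eq_integral hd hopen hball hβ hβ1 hy]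
  calc |∫ p, kernelIncrement D β y γ p ∂extremalMeasure D|
      ≤ ∫ p, 2 ^ d / (1 - β) ^ d * bdist D y * (dist p y ^ (d + 1))⁻¹ ∂extremalMeasure D := by
        refine norm_integral_le_of_norm_le (f := kernelIncrement D β y γ)
          ((integrable_dist_pow_inv hd hopen hball hy _).const_mul _) ?_
        filter_upwards [ae_bdist_le_dist hopen hy] with p hp
        exact abs_kernelIncrement_le hβ hβ1 hpos hp γ
    _ ≤ 2 ^ d / (1 - β) ^ d * bdist D y * ((d + 1) / bdist D y) := by
        rw [integral_const_mul]
        have := integral_dist_pow_succ_inv_le hd hopen hball hy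
        gcongr
    _ = _ := by field_simp

/-- The mean increment of the Riesz kernel over the sphere of radius `β d(y)` around `y`, bounded
below by means of the Poisson kernel identity. -/
lemma le_integral_kernelIncrement (hd : 1 ≤ d) (hβ : 0 < β) (hβ1 : β < 1)
    {y p : EuclideanSpace ℝ (Fin d)} (hpos : 0 < bdist D y) (hp : bdist D y ≤ dist p y) :
    (dist p y ^ d)⁻¹ / d * (β * bdist D y / dist p y) ^ 2 ≤
      ∫ γ, kernelIncrement D β y γ p ∂uniformSphere d := by
  have := isProbabilityMeasure_uniformSphere hd
  have hr : 0 < β * bdist D y := by positivity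
  have hR : dist p y = ‖y - p‖ := by rw [dist_comm, dist_eq_norm]
  have hrR : β * bdist D y < ‖y - p‖ := by rw [← hR]; nlinarith
  have hstep : ∀ γ, dist p (walkStep D β y γ) =
      ‖(y - p) + (β * bdist D y) • (γ : EuclideanSpace ℝ (Fin d))‖ := fun γ => by
    rw [dist_comm, dist_eq_norm, walkStep, sub_add_eq_add_sub]
  have hint : Integrable (fun γ : Metric.sphere (0 : EuclideanSpace ℝ (Fin d)) 1 =>
      (‖(y - p) + (β * bdist D y) • (γ : EuclideanSpace ℝ (Fin d))‖ ^ d)⁻¹)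
      (uniformSphere d) := by
    refine integrable_of_continuous_sphere hd (Continuous.inv₀ (by fun_prop) fun γ => ?_)
    refine pow_ne_zero _ (ne_of_gt ?_)
    have h1 := norm_sub_le_norm_add (y - p) ((β * bdist D y) • (γ : EuclideanSpace ℝ (Fin d)))
    rw [norm_smul, norm_eq_of_mem_sphere γ, mul_one, Real.norm_of_nonneg hr.le] at h1
    linarith
  simp only [kernelIncrement, hstep]
  rw [integral_sub (hint.div_const _) (integrable_const _), integral_div,
    integral_norm_add_smul_pow_inv hd hr hrR, integral_const, probReal_univ, one_smul, ← hR]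
  have hq : (β * bdist D y / dist p y) ^ 2 < 1 := by
    rw [sq_lt_one_iff₀ (by positivity), div_lt_one (hpos.trans_le hp), hR]
    exact hrR
  set q := (β * bdist D y / dist p y) ^ 2
  have h1 : 1 + q ≤ (1 - q)⁻¹ := by
    rw [le_inv_comm₀ (by positivity) (by linarith), inv_eq_one_div, le_div_iff₀ (by positivity)]
    nlinarith [sq_nonneg q]
  have h2 : 0 ≤ (dist p y ^ d)⁻¹ / d := by positivity
  calc (dist p y ^ d)⁻¹ / d * q = (dist p y ^ d)⁻¹ / d * (1 + q) - (dist p y ^ d)⁻¹ / d := by ring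
    _ ≤ (dist p y ^ d)⁻¹ / d * (1 - q)⁻¹ - (dist p y ^ d)⁻¹ / d := by gcongr
    _ = _ := by ring

lemma integrable_kernelIncrement (hd : 1 ≤ d) (hopen : IsOpen D) (hball : D ⊆ Metric.ball 0 1)
    (hβ : 0 < β) (hβ1 : β < 1) {y : EuclideanSpace ℝ (Fin d)} (hy : y ∈ D) :
    Integrable (fun q : Metric.sphere (0 : EuclideanSpace ℝ (Fin d)) 1 ×
      EuclideanSpace ℝ (Fin d) => kernelIncrement D β y q.1 q.2)
      ((uniformSphere d).prod (extremalMeasure D)) := by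
  have := isProbabilityMeasure_uniformSphere hd
  have hpos := bdist_pos hd hopen hball hy
  have hβ0 : 0 < 1 - β := by linarith
  refine Integrable.of_bound (measurable_kernelIncrement y).aestronglyMeasurable
    (2 ^ d / (1 - β) ^ d * bdist D y * (bdist D y ^ (d + 1))⁻¹) ?_
  filter_upwards [Measure.quasiMeasurePreserving_snd.ae (ae_bdist_le_dist hopen hy)] with q hq
  refine (abs_kernelIncrement_le hβ hβ1 hpos hq q.1).trans ?_
  gcongr

/-- The energy has a uniformly positive drift in one step: the complement of `D` carries a fixed
proportion of the ball `B(y, 2 d(y))`, where the mean increment of the Riesz kernel is at least of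
order `d(y) ^ (-d)`. -/
lemma exists_le_integral_energyIncrement (hd : 1 ≤ d) (hopen : IsOpen D)
    (hball : D ⊆ Metric.ball 0 1) (hthick : IsZeroThick D) (hβ : 0 < β) (hβ1 : β < 1) :
    ∃ L : ℝ, 0 < L ∧ ∀ y ∈ D, L ≤ ∫ γ, energyIncrement D β y γ ∂uniformSphere d := by
  obtain ⟨c, hc, hthick⟩ := exists_le_extremalMeasure_ball hball hthick
  have := isProbabilityMeasure_uniformSphere hd
  have hd0 : (0 : ℝ) < d := by exact_mod_cast hd
  refine ⟨c * β ^ 2 / (4 ^ (d + 1) * d), by positivity, fun y hy => ?_⟩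
  set s := bdist D y with hs
  have hs0 : 0 < s := bdist_pos hd hopen hball hy
  have hs1 : s ≤ 1 := bdist_le_one hd hopen hball hy
  obtain ⟨x, hx, hyx⟩ := exists_frontier_dist_eq_bdist hd hball hy
  have hmass : c * (s / 2) ^ d ≤ (extremalMeasure D).real (Metric.ball y (2 * s)) := by
    have h1 : Metric.ball x (s / 2) ⊆ Metric.ball y (2 * s) := fun p hp => by
      rw [Metric.mem_ball] at hp ⊢
      have h2 := dist_triangle p x y
      rw [dist_comm x y, hyx] at h2
      linarith
    refine (ENNReal.ofReal_le_iff_le_toReal (measure_ne_top _ _)).1 ?_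
    exact (hthick x hx (s / 2) (by linarith) (by linarith)).trans (measure_mono h1)
  have hint := integrable_kernelIncrement hd hopen hball hβ hβ1 hy
  simp only [energyIncrement_eq_integral hd hopen hball hβ hβ1 hy]
  rw [integral_integral_swap hint]
  set b : ℝ := ((2 * s) ^ d)⁻¹ / d * (β * s / (2 * s)) ^ 2 with hb
  calc c * β ^ 2 / (4 ^ (d + 1) * d) = b * (c * (s / 2) ^ d) := by
        have : (4 : ℝ) ^ (d + 1) = 2 ^ d * 2 ^ d * 4 := by
          rw [pow_succ, ← mul_pow]; norm_num
        rw [hb, this, div_pow s 2 d, mul_pow]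
        field_simp
        norm_num
    _ ≤ b * (extremalMeasure D).real (Metric.ball y (2 * s)) := by gcongr
    _ = ∫ p, (Metric.ball y (2 * s)).indicator (fun _ => b) p ∂extremalMeasure D := by
        rw [integral_indicator_const _ Metric.isOpen_ball.measurableSet, smul_eq_mul, mul_comm]
    _ ≤ ∫ p, ∫ γ, kernelIncrement D β y γ p ∂uniformSphere d ∂extremalMeasure D := by
        refine integral_mono_ae ((integrable_const b).indicator Metric.isOpen_ball.measurableSet)
          hint.integral_prod_right ?_
        filter_upwards [ae_bdist_le_dist hopen hy] with p hp
        refine le_trans ?_ (le_integral_kernelIncrement hd hβ hβ1 hs0 hp)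
        have hR : 0 < dist p y := hs0.trans_le hp
        by_cases hpb : p ∈ Metric.ball y (2 * s)
        · rw [Set.indicator_of_mem hpb, hb]
          have : dist p y ≤ 2 * s := (Metric.mem_ball.1 hpb).le
          gcongr
        · rw [Set.indicator_of_notMem hpb]
          positivity

end Drift

/-! ### The drift of the energy process -/

section Probability

variable {Ω : Type*} {mΩ : MeasurableSpace Ω}

lemma indepFun_prodMk_left_of_indepFun_prodMk_right {P : Measure Ω} [IsProbabilityMeasure P]
    {α β γ : Type*} [MeasurableSpace α] [MeasurableSpace β] [MeasurableSpace γ] {f : Ω → α}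
    {g : Ω → β} {h : Ω → γ} (hf : Measurable f) (hg : Measurable g) (hh : Measurable h)
    (hfgh : IndepFun f (fun ω => (g ω, h ω)) P) (hgh : IndepFun g h P) :
    IndepFun (fun ω => (f ω, g ω)) h P := by
  have hfg : IndepFun f g P := hfgh.comp measurable_id measurable_fst
  have hfP := Measure.isProbabilityMeasure_map (μ := P) hf.aemeasurable
  have hgP := Measure.isProbabilityMeasure_map (μ := P) hg.aemeasurable
  have hhP := Measure.isProbabilityMeasure_map (μ := P) hh.aemeasurable
  have h1 := (indepFun_iff_map_prod_eq_prod_map_map hf.aemeasurable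
    (hg.prodMk hh).aemeasurable).1 hfgh
  rw [(indepFun_iff_map_prod_eq_prod_map_map hg.aemeasurable hh.aemeasurable).1 hgh] at h1
  rw [indepFun_iff_map_prod_eq_prod_map_map (hf.prodMk hg).aemeasurable hh.aemeasurable,
    (indepFun_iff_map_prod_eq_prod_map_map hf.aemeasurable hg.aemeasurable).1 hfg,
    ← ((measurePreserving_prodAssoc (P.map f) (P.map g) (P.map h)).symm _).map_eq, ← h1,
    Measure.map_map (MeasurableEquiv.measurable _) (hf.prodMk (hg.prodMk hh))]
  rfl

/-- A lower bound for all averages of `f` over the sets of a sub-σ-algebra is a lower bound for the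
conditional expectation. -/
lemma ae_lt_condExp_of_forall_setIntegral_le {Q : Measure Ω} [IsFiniteMeasure Q]
    {m : MeasurableSpace Ω} (hm : m ≤ mΩ) {f : Ω → ℝ} (hf : Integrable f Q) {L L' : ℝ}
    (hL : L < L') (h : ∀ B, MeasurableSet[m] B → L' * Q.real B ≤ ∫ ω in B, f ω ∂Q) :
    ∀ᵐ ω ∂Q, L < (Q[f|m]) ω := by
  have hcond : Measurable[m] (Q[f|m]) := stronglyMeasurable_condExp.measurable
  have hS : MeasurableSet[m] {ω | (Q[f|m]) ω ≤ L} := hcond measurableSet_Iic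
  have h1 := h _ hS
  rw [← setIntegral_condExp hm hf hS] at h1
  have h2 : ∫ ω in {ω | (Q[f|m]) ω ≤ L}, (Q[f|m]) ω ∂Q ≤
      ∫ _ in {ω | (Q[f|m]) ω ≤ L}, L ∂Q :=
    setIntegral_mono_on integrable_condExp.integrableOn
      (integrable_const L).integrableOn (hm _ hS) fun ω hω => hω
  rw [setIntegral_const, smul_eq_mul] at h2
  have h3 : Q.real {ω | (Q[f|m]) ω ≤ L} = 0 := by
    have := measureReal_nonneg (μ := Q) (s := {ω | (Q[f|m]) ω ≤ L})
    nlinarith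
  have h4 : Q {ω | (Q[f|m]) ω ≤ L} = 0 := (measureReal_eq_zero_iff).1 h3
  rw [ae_iff]
  simpa only [not_lt] using h4

end Probability

section Walk

variable {d : ℕ} {D : Set (EuclideanSpace ℝ (Fin d))} {β : ℝ} {Ω : Type*}
  {mΩ : MeasurableSpace Ω} {P : Measure Ω} {X : ℕ → Ω → EuclideanSpace ℝ (Fin d)}
  {γ : ℕ → Ω → Metric.sphere (0 : EuclideanSpace ℝ (Fin d)) 1}

/-- The initial position and the directions chosen before time `n`, which determine the walk up to
time `n`. -/
def historyVar (X : ℕ → Ω → EuclideanSpace ℝ (Fin d))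
    (γ : ℕ → Ω → Metric.sphere (0 : EuclideanSpace ℝ (Fin d)) 1) (n : ℕ) (ω : Ω) :
    EuclideanSpace ℝ (Fin d) ×
      (Finset.range n → Metric.sphere (0 : EuclideanSpace ℝ (Fin d)) 1) :=
  (X 0 ω, fun k => γ k ω)

/-- The σ-algebra of the events known before the direction at time `n` is chosen. -/
@[reducible] def history (X : ℕ → Ω → EuclideanSpace ℝ (Fin d))
    (γ : ℕ → Ω → Metric.sphere (0 : EuclideanSpace ℝ (Fin d)) 1) (n : ℕ) : MeasurableSpace Ω :=
  MeasurableSpace.comap (historyVar X γ n) inferInstance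

namespace IsWalkOnSpheres

lemma measurable_historyVar (hW : IsWalkOnSpheres D β P X γ) (n : ℕ) :
    Measurable (historyVar X γ n) :=
  hW.measurable_init.prodMk (measurable_pi_lambda _ fun k => hW.measurable_dir k)

lemma history_le (hW : IsWalkOnSpheres D β P X γ) (n : ℕ) : history X γ n ≤ mΩ :=
  (hW.measurable_historyVar n).comap_le

lemma measurable_history (hW : IsWalkOnSpheres D β P X γ) {n k : ℕ} (hk : k ≤ n) :
    Measurable[history X γ n] (X k) := by
  have hvar : Measurable[history X γ n] (historyVar X γ n) := comap_measurable _
  induction k with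
  | zero => exact measurable_fst.comp hvar
  | succ k ih =>
    have hdir : Measurable[history X γ n] (γ k) :=
      (measurable_pi_apply (⟨k, Finset.mem_range.2 hk⟩ : Finset.range n)).comp
        (measurable_snd.comp hvar)
    have hstep : X (k + 1) = fun ω => walkStep D β (X k ω) (γ k ω) := funext (hW.step k)
    rw [hstep]
    exact measurable_walkStep.comp ((ih (by omega)).prodMk hdir)

lemma measurable (hW : IsWalkOnSpheres D β P X γ) (n : ℕ) : Measurable (X n) :=
  (hW.measurable_history le_rfl).mono (hW.history_le n) le_rfl

lemma measurableSet_running (hW : IsWalkOnSpheres D β P X γ) (ε : ℝ) (n : ℕ) :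
    MeasurableSet[history X γ n] (running D X ε n) := by
  have h : running D X ε n = ⋂ k, ⋂ (_ : k ≤ n), {ω | ε < bdist D (X k ω)} := by
    ext ω
    simp [running]
  rw [h]
  refine MeasurableSet.iInter fun k => MeasurableSet.iInter fun hk => ?_
  exact (measurable_bdist.comp (hW.measurable_history hk)) measurableSet_Ioi

lemma indepFun_historyVar [IsProbabilityMeasure P] (hW : IsWalkOnSpheres D β P X γ) (n : ℕ) :
    IndepFun (historyVar X γ n) (γ n) P := by
  have hpast : Measurable fun ω (k : Finset.range n) => γ k ω :=
    measurable_pi_lambda _ fun k => hW.measurable_dir k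
  have h1 : IndepFun (X 0) (fun ω => ((fun k : Finset.range n => γ k ω), γ n ω)) P :=
    hW.indep_init.comp (φ := id) (ψ := fun g : ℕ → Metric.sphere (0 : EuclideanSpace ℝ (Fin d)) 1 =>
      ((fun k : Finset.range n => g k), g n)) measurable_id
      ((measurable_pi_lambda _ fun k => measurable_pi_apply _).prodMk (measurable_pi_apply n))
  have h2 : IndepFun (fun ω (k : Finset.range n) => γ k ω) (γ n) P :=
    (hW.indep_dir.indepFun_finset (Finset.range n) {n} (by simp) hW.measurable_dir).comp
      (φ := id) (ψ := fun g : ({n} : Finset ℕ) → Metric.sphere (0 : EuclideanSpace ℝ (Fin d)) 1 =>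
        g ⟨n, Finset.mem_singleton_self n⟩) measurable_id
      (measurable_pi_apply _)
  exact indepFun_prodMk_left_of_indepFun_prodMk_right hW.measurable_init hpast
    (hW.measurable_dir n) h1 h2

/-- On an event of the past, the direction at time `n` is uniform and independent of the
position. -/
lemma map_restrict_eq_prod [IsProbabilityMeasure P] (hW : IsWalkOnSpheres D β P X γ) (n : ℕ)
    {A : Set Ω} (hA : MeasurableSet[history X γ n] A) :
    (P.restrict A).map (fun ω => (X n ω, γ n ω)) =
      ((P.restrict A).map (X n)).prod (uniformSphere d) := by
  have hσ : IsProbabilityMeasure (uniformSphere d) := by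
    rw [← hW.law_dir n]
    exact Measure.isProbabilityMeasure_map (hW.measurable_dir n).aemeasurable
  refine (Measure.prod_eq fun S T hS hT => ?_).symm
  have hXS : MeasurableSet[history X γ n] (X n ⁻¹' S) := hW.measurable_history le_rfl hS
  have hind := (Indep_iff _ _ P).1 (hW.indepFun_historyVar n) _ _ (hXS.inter hA) ⟨T, hT, rfl⟩
  rw [Measure.map_apply ((hW.measurable n).prodMk (hW.measurable_dir n)) (hS.prod hT),
    Measure.map_apply (hW.measurable n) hS,
    Measure.restrict_apply ((hW.measurable n).prodMk (hW.measurable_dir n) (hS.prod hT)),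
    Measure.restrict_apply (hW.measurable n hS), ← hW.law_dir n,
    Measure.map_apply (hW.measurable_dir n) hT, ← hind]
  congr 1
  ext ω
  simp only [Set.mem_inter_iff, Set.mem_preimage, Set.mem_prod]
  tauto

lemma ae_mem (hW : IsWalkOnSpheres D β P X γ) (hd : 1 ≤ d) (hopen : IsOpen D)
    (hball : D ⊆ Metric.ball 0 1) (hβ : 0 < β) (hβ1 : β < 1) (n : ℕ) :
    ∀ᵐ ω ∂P, X n ω ∈ D := by
  induction n with
  | zero => exact hW.init_mem
  | succ n ih =>
    filter_upwards [ih] with ω hω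
    rw [hW.step]
    exact walkStep_mem hd hopen hball hβ hβ1 hω (γ n ω)

lemma energyProcess_sub (hW : IsWalkOnSpheres D β P X γ) (n : ℕ) (ω : Ω) :
    energyProcess D X (n + 1) ω - energyProcess D X n ω =
      energyIncrement D β (X n ω) (γ n ω) := by
  rw [energyProcess, energyProcess, hW.step]
  rfl

/-- A lower bound for the mean increment of the energy at every point of `D` carries over to the
increments of the energy process, averaged over any event of the past. -/
lemma le_setIntegral_energyIncrement [IsProbabilityMeasure P] (hW : IsWalkOnSpheres D β P X γ)
    (hd : 1 ≤ d) (hopen : IsOpen D) (hball : D ⊆ Metric.ball 0 1) (hβ : 0 < β) (hβ1 : β < 1)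
    {L : ℝ} (hL : ∀ y ∈ D, L ≤ ∫ g, energyIncrement D β y g ∂uniformSphere d) (n : ℕ)
    {A : Set Ω} (hA : MeasurableSet[history X γ n] A) :
    L * P.real A ≤ ∫ ω in A, energyIncrement D β (X n ω) (γ n ω) ∂P := by
  have hσ := isProbabilityMeasure_uniformSphere hd
  obtain ⟨C, hC⟩ := exists_abs_energyIncrement_le hd hopen hball hβ hβ1
  have hpair := (hW.measurable n).prodMk (hW.measurable_dir n)
  have hmeas := measurable_energyIncrement (β := β) hopen
  set ν := (P.restrict A).map (X n) with hν
  have hνfin : IsFiniteMeasure ν := Measure.isFiniteMeasure_map _ _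
  have hνD : ∀ᵐ y ∂ν, y ∈ D := by
    refine (ae_map_iff (hW.measurable n).aemeasurable hopen.measurableSet).2 ?_
    exact ae_restrict_of_ae (hW.ae_mem hd hopen hball hβ hβ1 n)
  have hint : Integrable (fun q : EuclideanSpace ℝ (Fin d) ×
      Metric.sphere (0 : EuclideanSpace ℝ (Fin d)) 1 => energyIncrement D β q.1 q.2)
      (ν.prod (uniformSphere d)) := by
    refine Integrable.of_bound hmeas.aestronglyMeasurable C ?_
    filter_upwards [Measure.quasiMeasurePreserving_fst.ae hνD] with q hq using hC q.1 hq q.2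
  have h1 : ∫ ω in A, energyIncrement D β (X n ω) (γ n ω) ∂P =
      ∫ y, ∫ g, energyIncrement D β y g ∂uniformSphere d ∂ν := by
    rw [← integral_prod _ hint, hν, ← hW.map_restrict_eq_prod n hA,
      integral_map hpair.aemeasurable hmeas.aestronglyMeasurable]
  have h2 : ν.real Set.univ = P.real A := by
    rw [hν, map_measureReal_apply (hW.measurable n) MeasurableSet.univ, Set.preimage_univ,
      measureReal_restrict_apply_univ]
  calc L * P.real A = ∫ _, L ∂ν := by rw [integral_const, h2, smul_eq_mul, mul_comm]
    _ ≤ ∫ y, ∫ g, energyIncrement D β y g ∂uniformSphere d ∂ν := by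
        refine integral_mono_ae (integrable_const L) hint.integral_prod_left ?_
        filter_upwards [hνD] with y hy using hL y hy
    _ = _ := h1.symm

/-- The drift under the law conditioned on an event of the past. -/
lemma hasDrift_cond [IsProbabilityMeasure P] (hW : IsWalkOnSpheres D β P X γ)
    (hd : 1 ≤ d) (hopen : IsOpen D) (hball : D ⊆ Metric.ball 0 1) (hβ : 0 < β) (hβ1 : β < 1)
    {L L' : ℝ} (hLL' : L < L')
    (hL : ∀ y ∈ D, L' ≤ ∫ g, energyIncrement D β y g ∂uniformSphere d) (n : ℕ)
    {A : Set Ω} (hA : MeasurableSet[history X γ n] A) :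
    HasDrift D P[|A] X n L := by
  obtain ⟨C, hC⟩ := exists_abs_energyIncrement_le hd hopen hball hβ hβ1
  have hsub : (fun ω => energyProcess D X (n + 1) ω - energyProcess D X n ω) =
      fun ω => energyIncrement D β (X n ω) (γ n ω) := funext (hW.energyProcess_sub n)
  have hint : Integrable (fun ω => energyIncrement D β (X n ω) (γ n ω)) P[|A] := by
    refine Integrable.of_bound ((measurable_energyIncrement hopen).comp
      ((hW.measurable n).prodMk (hW.measurable_dir n))).aestronglyMeasurable C ?_
    filter_upwards [cond_absolutelyContinuous.ae_le (hW.ae_mem hd hopen hball hβ hβ1 n)]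
      with ω hω using hC _ hω _
  have hU : Measurable[history X γ n] (energyProcess D X n) :=
    ((measurable_energy hopen).comp (hW.measurable_history le_rfl)).ennreal_toReal
  have hcomap : MeasurableSpace.comap (energyProcess D X n) inferInstance ≤ history X γ n :=
    hU.comap_le
  rw [HasDrift, hsub]
  refine ⟨hint, ae_lt_condExp_of_forall_setIntegral_le (hcomap.trans (hW.history_le n)) hint hLL'
    fun B hB => ?_⟩
  have hB' := hcomap _ hB
  have hB'' := hW.history_le n _ hB'
  have h := hW.le_setIntegral_energyIncrement hd hopen hball hβ hβ1 hL n (hB'.inter hA)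
  rw [measureReal_def, ProbabilityTheory.cond, Measure.restrict_smul, integral_smul_measure,
    Measure.restrict_restrict hB'', Measure.smul_apply, Measure.restrict_apply hB'', smul_eq_mul,
    smul_eq_mul, ENNReal.toReal_mul, mul_left_comm]
  exact mul_le_mul_of_nonneg_left h ENNReal.toReal_nonneg

end IsWalkOnSpheres

end Walk

end WalkOnSpheres

theorem mainTheorem5 {d : ℕ} (hd : 1 ≤ d) (D : Set (EuclideanSpace ℝ (Fin d)))
    (hopen : IsOpen D) (hball : D ⊆ Metric.ball 0 1) (hthick : WalkOnSpheres.IsZeroThick D) :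
    -- the energy function is finite on `D`
    (∀ x ∈ D, WalkOnSpheres.energy D x < ∞) ∧
    -- constants `δ`, `η` exist
    (∃ δ η : ℝ, δ < 2 ∧ WalkOnSpheres.IsBinderBravermanPair D δ η) ∧
    -- and for all such constants the energy drifts upwards in one step
    (∀ δ η : ℝ, WalkOnSpheres.IsBinderBravermanPair D δ η →
      ∀ β : ℝ, 0 < β → β < 1 → 1 - δ / 2 < β → β < 1 - δ / 4 →
        ∃ L : ℝ, 0 < L ∧
          ∀ (Ω : Type*) [MeasurableSpace Ω] (P : Measure Ω) [IsProbabilityMeasure P]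
            (X : ℕ → Ω → EuclideanSpace ℝ (Fin d))
            (γ : ℕ → Ω → Metric.sphere (0 : EuclideanSpace ℝ (Fin d)) 1),
            WalkOnSpheres.IsWalkOnSpheres D β P X γ → ∀ n : ℕ,
              WalkOnSpheres.HasDrift D P X n L ∧
              ∀ ε : ℝ, 0 < ε →
                WalkOnSpheres.HasDrift D (P[|WalkOnSpheres.running D X ε n]) X n L) := by
  refine ⟨fun x hx => ?_, WalkOnSpheres.exists_isBinderBravermanPair hd hopen hball hthick, ?_⟩
  · rw [WalkOnSpheres.energy_eq_ofReal_integral hd hopen hball hx]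
    exact ENNReal.ofReal_lt_top
  · intro δ η _ β hβ hβ1 _ _
    obtain ⟨L, hL0, hL⟩ :=
      WalkOnSpheres.exists_le_integral_energyIncrement hd hopen hball hthick hβ hβ1
    refine ⟨L / 2, by positivity, fun Ω _ P _ X γ hW n => ⟨?_, fun ε _ => ?_⟩⟩
    · have h := hW.hasDrift_cond hd hopen hball hβ hβ1 (half_lt_self hL0) hL n MeasurableSet.univ
      rwa [cond_univ] at h
    · exact hW.hasDrift_cond hd hopen hball hβ hβ1 (half_lt_self hL0) hL n
        (hW.measurableSet_running ε n)
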